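/- Let $\Omega\subset\mathbb{RP}^2$ be a properly convex domain, that is, a nonempty open set whose closure lies in an affine patch of $\mathbb{RP}^2$ in which $\Omega$ is convex. In an affine patch containing $\Omega$, the Hilbert Finsler norm of a vector $u\neq 0$ at $x\in\Omega$ is $$\|u\|_{\Omega,x}=\frac12\left(\frac1{|x-p|}+\frac1{|x-q|}\right)|u|,$$ where $p,q$ are the end points of the chord of $\Omega$ through $x$ in the direction $u$ (with $1/|x-p|=0$ if $p$ is at infinity). The Hilbert area of a measurable set $X\subset\Omega$ is $$\mathrm{area}_\Omega(X)=\int_X\frac{d\lambda(x)}{K_x}\in[0,\infty],$$ where $\lambda$ is Lebesgue measure in the patch and $K_x$ is the supremum of $\lambda(\{\alpha a+\beta b: 0\le\alpha,\beta\le1\})$ over all vectors $a,b$ with $\|a\|_{\Omega,x},\|b\|_{\Omega,x}\le1$; this does not depend on the patch. Let $T'$ be a closed triangle in $\mathbb{RP}^2$ such that $T'\cap\partial\Omega$ consists of exactly the three vertices of $T'$, and let $T=T'\cap\Omega$ be the corresponding ideal triangle in $\Omega$. Let $t$ be a shape parameter of $T$ in $\Omega$: there is a basis $v_0,v_1,v_2$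 of $\mathbb R^3$ such that $\Omega$ is contained in the open triangle $\Delta=\{[x_0v_0+x_1v_1+x_2v_2]: x_i>0\}$, the vertices of $T'$ are $[v_0+av_1]$, $[v_1+bv_2]$, $[v_2+cv_0]$ with $a,b,c>0$, and $t=abc$. Then $$\mathrm{area}_\Omega(T)\ \ge\ \frac{\pi^2+(\log t)^2}{8},$$ with equality if and only if $\Omega$ is the interior of a triangle in $\mathbb{RP}^2$. -/

import Mathlib

open MeasureTheory
open scoped ENNReal

/-- The real projective plane. -/
abbrev RP2 : Type := Projectivization ℝ (Fin 3 → ℝ)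

/-- The usual topology of the projective plane: the quotient topology from `ℝ³ ∖ {0}`. -/
noncomputable instance RP2.topology : TopologicalSpace RP2 :=
  TopologicalSpace.coinduced (Projectivization.mk' ℝ) inferInstance

/-- A basis of `ℝ³`. It serves both for triangles (its members represent the vertices) and for
affine charts of the projective plane. -/
abbrev Frame : Type := Module.Basis (Fin 3) ℝ (Fin 3 → ℝ)

theorem affineVec_ne_zero (e : Frame) (x : Fin 2 → ℝ) : x 0 • e 0 + x 1 • e 1 + e 2 ≠ 0 := by
  intro h
  have h2 := congrArg (fun z => e.repr z 2) h
  simp at h2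

/-- The affine chart `(x, y) ↦ [x e₀ + y e₁ + e₂]`, a parametrization of the complement of the
projective line through `[e₀]` and `[e₁]`. As `e` varies these are all affine charts. -/
noncomputable def affineChart (e : Frame) (x : Fin 2 → ℝ) : RP2 :=
  Projectivization.mk ℝ (x 0 • e 0 + x 1 • e 1 + e 2) (affineVec_ne_zero e x)

/-- A properly convex domain: a nonempty open set whose closure lies in an affine patch, in which
the set is convex. -/
def IsProperlyConvex (Ω : Set RP2) : Prop :=
  IsOpen Ω ∧ Ω.Nonempty ∧
    ∃ e : Frame, closure Ω ⊆ Set.range (affineChart e) ∧ Convex ℝ (affineChart e ⁻¹' Ω)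

/-! ### Triangles -/

/-- The closed triangle `{[x₀v₀ + x₁v₁ + x₂v₂] : xᵢ ≥ 0, not all zero}`. -/
def closedTriangle (v : Frame) : Set RP2 :=
  {P | ∃ x : Fin 3 → ℝ, (∀ i, 0 ≤ x i) ∧
    ∃ h : ∑ i, x i • v i ≠ 0, P = Projectivization.mk ℝ (∑ i, x i • v i) h}

/-- The interior `{[x₀v₀ + x₁v₁ + x₂v₂] : xᵢ > 0}` of the triangle. -/
def openTriangle (v : Frame) : Set RP2 :=
  {P | ∃ x : Fin 3 → ℝ, (∀ i, 0 < x i) ∧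
    ∃ h : ∑ i, x i • v i ≠ 0, P = Projectivization.mk ℝ (∑ i, x i • v i) h}

/-- The vertices of the triangle. -/
def triangleVertices (v : Frame) : Set RP2 :=
  Set.range fun i => Projectivization.mk ℝ (v i) (v.ne_zero i)

/-- The triangle spanned by `w` gives a (proper) ideal triangle `closedTriangle w ∩ Ω` of `Ω`:
it meets the boundary of `Ω` exactly in its three vertices. -/
def IsIdealTriangle (Ω : Set RP2) (w : Frame) : Prop :=
  closedTriangle w ∩ frontier Ω = triangleVertices w

/-- Two vectors represent the same point of the projective plane. -/
def SamePoint (x y : Fin 3 → ℝ) : Prop := ∃ k : ℝ, k ≠ 0 ∧ x = k • y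

/-- `t` is the shape parameter of the ideal triangle `w` in the triangle `v`: its vertices are
`[v₀ + a v₁]`, `[v₁ + b v₂]`, `[v₂ + c v₀]` with `a, b, c > 0` and `t = abc`. -/
def IsShapeInTriangle (v w : Frame) (t : ℝ) : Prop :=
  ∃ a b c : ℝ, 0 < a ∧ 0 < b ∧ 0 < c ∧
    SamePoint (w 0) (v 0 + a • v 1) ∧ SamePoint (w 1) (v 1 + b • v 2) ∧
    SamePoint (w 2) (v 2 + c • v 0) ∧ t = a * b * c

/-- `t` is a shape parameter of the ideal triangle `w` in `Ω`: it is the shape parameter in a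
triangle which contains `Ω` and has the vertices of the ideal triangle on its three sides. The
sides of such a triangle are supporting lines of `Ω` at these vertices, so that it is unique
if `Ω` has a unique tangent line at each of them. -/
def IsShapeParameter (Ω : Set RP2) (w : Frame) (t : ℝ) : Prop :=
  ∃ v : Frame, Ω ⊆ openTriangle v ∧ IsShapeInTriangle v w t

/-! ### Hilbert area -/

/-- The Hilbert Finsler norm of the tangent vector `u` at the point `x` of a convex open set
`D ⊆ ℝ²`, normalized to have curvature `-1` if `D` is a disc. The gauge of `D - x` at `u` is
`|u| / |p - x|`, where `p` is the point in which the ray from `x` in direction `u` leaves `D`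
(and `0` if the ray stays in `D`); hence this is `(1/2) (1 / |x - p| + 1 / |x - q|) |u|`, where
`p` and `q` are the end points of the chord of `D` through `x` in direction `u`. -/
noncomputable def hilbertNorm (D : Set (Fin 2 → ℝ)) (x u : Fin 2 → ℝ) : ℝ :=
  (gauge {z | x + z ∈ D} u + gauge {z | x + z ∈ D} (-u)) / 2

/-- The density, with respect to Lebesgue measure, of the parallelogram measure (p-area) of a
norm `N` on `ℝ²`: the inverse of the largest Lebesgue measure of a parallelogram spanned by two
vectors of norm at most one. -/
noncomputable def pAreaDensity (N : (Fin 2 → ℝ) → ℝ) : ℝ≥0∞ :=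
  (⨆ (a : Fin 2 → ℝ) (b : Fin 2 → ℝ) (_ : N a ≤ 1) (_ : N b ≤ 1),
    volume (parallelepiped ![a, b]))⁻¹

/-- The Hilbert area of a subset `X` of `Ω`: the integral over `X` of the p-area form of the
Hilbert Finsler metric of `Ω`, written in the coordinates of an affine chart `e` whose patch
contains `Ω`. -/
noncomputable def hilbertArea (e : Frame) (Ω X : Set RP2) : ℝ≥0∞ :=
  ∫⁻ x in affineChart e ⁻¹' X, pAreaDensity (hilbertNorm (affineChart e ⁻¹' Ω) x)

/-! Let `y₀, y₁, y₂` be coordinates with respect to the circumscribed triangle Δ. In the logarithmic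
coordinates `(log (y₁/y₀), log (y₂/y₀))` the Hilbert geometry of Δ is a normed plane whose unit ball
is the hexagon `|p|, |q|, |p - q| ≤ 2`, and the largest parallelogram spanned by two of its vectors
has area 4. Since Ω ⊆ Δ, the Hilbert norm of Ω is at least that of Δ, so its unit balls lie in the
hexagon and its area is at least a quarter of the Lebesgue measure of the logarithmic plane
(`quarter_volume_image_logChart_le`). The image of T in this plane depends only on `t` up to
translation; integrating the lengths of its slices leads to values of the dilogarithm and gives `(π²
+ log² t) / 2` (`volume_logTriangle`).

For equality, suppose first that Ω is a triangle. It then coincides with Δ, because each side of Δ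
has to contain a side of Ω (`IsConeOver.mem_of_eq_openTriangle`), and the unit balls fill the
hexagon. If Ω ≠ Δ, some vertex of Δ is outside the closure of Ω, say `v₀`. A further linear form `y₁
+ y₂ - ε y₀` is then positive on Ω. Over a part of T of positive measure it confines the unit balls
to a strip `|p| ≤ m` with `m < 2`, where parallelograms have area at most `m (4 - m) < 4`
(`lt_lintegral_chartTriangle`).

On the projective side Ω is replaced by one of the two convex cones over it. Four closed triangles
share the vertices of T'; that T' is the one inside Δ follows from connectedness
(`IsConeOver.exists_common_sign`). -/

/-! ### Dilogarithm integrals -/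

open Set Real in
theorem integral_neg_log_one_sub_exp_neg :
    IntegrableOn (fun s : ℝ => -log (1 - exp (-s))) (Ioi 0) ∧
      ∫ s in Ioi (0 : ℝ), -log (1 - exp (-s)) = π ^ 2 / 6 := by
  -- The terms of the power series of `-log (1 - x)` at `x = exp (-s)`; their integrals are the
  -- terms of ζ(2).
  set F : ℕ → ℝ → ℝ := fun n s => exp (-((n : ℝ) + 1) * s) / (n + 1) with hF
  have hneg (n : ℕ) : -((n : ℝ) + 1) < 0 := by
    have : (0 : ℝ) ≤ n := n.cast_nonneg
    linarith
  have hint (n : ℕ) : IntegrableOn (F n) (Ioi 0) :=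
    (integrableOn_exp_mul_Ioi (hneg n) 0).div_const _
  have hval (n : ℕ) : ∫ s in Ioi (0 : ℝ), F n s = 1 / ((n : ℝ) + 1) ^ 2 := by
    have h1 := (hneg n).ne
    have h2 : (n : ℝ) + 1 ≠ 0 := by
      have := hneg n
      linarith
    simp only [hF]
    rw [integral_div, integral_exp_mul_Ioi (hneg n)]
    simp only [mul_zero, exp_zero]
    field_simp
  have hnorm (n : ℕ) : ∫ s in Ioi (0 : ℝ), ‖F n s‖ = 1 / ((n : ℝ) + 1) ^ 2 := by
    rw [← hval n]
    congr 1
    ext s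
    rw [norm_eq_abs, abs_of_nonneg]
    simp only [hF]
    positivity
  have hz : HasSum (fun n : ℕ => 1 / ((n : ℝ) + 1) ^ 2) (π ^ 2 / 6) := by
    have := (hasSum_nat_add_iff' 1).2 hasSum_zeta_two
    simpa using this
  have hpt : ∀ s ∈ Ioi (0 : ℝ), HasSum (fun n => F n s) (-log (1 - exp (-s))) := by
    intro s hs
    have h1 : |exp (-s)| < 1 := by
      rw [abs_of_pos (exp_pos _)]
      exact exp_lt_one_iff.2 (neg_lt_zero.2 hs)
    convert Real.hasSum_pow_div_log_of_abs_lt_one h1 using 2 with n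
    simp only [hF]
    rw [← Real.exp_nat_mul]
    congr 2
    push_cast
    ring
  have hsum : Summable fun n => ∫ s in Ioi (0 : ℝ), ‖F n s‖ := by
    simp only [hnorm]
    exact hz.summable
  have hS := hasSum_integral_of_summable_integral_norm hint hsum
  simp only [hval] at hS
  have hEq : ∫ s in Ioi (0 : ℝ), ∑' n, F n s = ∫ s in Ioi (0 : ℝ), -log (1 - exp (-s)) :=
    setIntegral_congr_fun measurableSet_Ioi fun s hs => (hpt s hs).tsum_eq
  have hv := hEq.symm.trans (hS.unique hz)
  refine ⟨?_, hv⟩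
  -- Integrability comes for free: a non-integrable function has integral 0 by convention, but the
  -- integral is positive.
  by_contra h
  have h0 : ∫ s in Ioi (0 : ℝ), -log (1 - exp (-s)) = 0 := integral_undef h
  rw [h0] at hv
  have : (0 : ℝ) < π ^ 2 / 6 := by positivity
  linarith

-- From `1 - x² = (1 - x)(1 + x)` at `x = exp (-s)`, the integrand is `g s - g (2 * s)` with `g` the
-- integrand of the preceding lemma. Rescaling halves the integral of `g`.
open Set Real in
theorem integral_log_one_add_exp_neg :
    IntegrableOn (fun s : ℝ => log (1 + exp (-s))) (Ioi 0) ∧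
      ∫ s in Ioi (0 : ℝ), log (1 + exp (-s)) = π ^ 2 / 12 := by
  obtain ⟨h1, h2⟩ := integral_neg_log_one_sub_exp_neg
  set g : ℝ → ℝ := fun s => -log (1 - exp (-s)) with hg
  have h3 : IntegrableOn (fun s => g (2 * s)) (Ioi 0) := by
    rw [integrableOn_Ioi_comp_mul_left_iff g 0 two_pos]
    simpa using h1
  have h4 : ∫ s in Ioi (0 : ℝ), g (2 * s) = π ^ 2 / 12 := by
    rw [integral_comp_mul_left_Ioi g 0 two_pos]
    simp only [mul_zero, h2, smul_eq_mul]
    ring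
  have h5 : EqOn (fun s => g s - g (2 * s)) (fun s => log (1 + exp (-s))) (Ioi 0) := by
    intro s hs
    have hs1 : exp (-s) < 1 := exp_lt_one_iff.2 (neg_lt_zero.2 hs)
    have hs0 := exp_pos (-s)
    have : exp (-(2 * s)) = exp (-s) * exp (-s) := by
      rw [← exp_add]
      ring_nf
    simp only [hg, this]
    rw [show 1 - exp (-s) * exp (-s) = (1 - exp (-s)) * (1 + exp (-s)) by ring,
      log_mul (by linarith) (by linarith)]
    ring
  refine ⟨(h1.sub h3).congr_fun h5 measurableSet_Ioi, ?_⟩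
  rw [← setIntegral_congr_fun measurableSet_Ioi h5, integral_sub h1 h3, h2, h4]
  ring

open Set Real in
theorem continuous_log_one_add_exp_neg : Continuous fun s : ℝ => log (1 + exp (-s)) := by
  refine Continuous.log (by fun_prop) fun s => ?_
  positivity

open Set Real in
theorem integrableOn_log_one_add_exp_neg (l : ℝ) :
    IntegrableOn (fun s : ℝ => log (1 + exp (-s))) (Ioi l) := by
  have h1 : IntegrableOn (fun s : ℝ => log (1 + exp (-s))) (Icc l (max l 0)) :=
    continuous_log_one_add_exp_neg.continuousOn.integrableOn_Icc
  refine (h1.union integral_log_one_add_exp_neg.1).mono_set fun s hs => ?_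
  rcases le_or_gt s 0 with h | h
  · exact Or.inl ⟨le_of_lt hs, h.trans (le_max_right _ _)⟩
  · exact Or.inr h

-- The inversion formula of the dilogarithm, and the source of the term `log² t`. Both tails are
-- compared with the tail from 0; by `log (1 + exp s) = log (1 + exp (-s)) + s` the corrections
-- cancel up to the integral of `s` over `[0, l]`.
open Set Real in
theorem integral_log_one_add_exp_neg_Ioi_add (l : ℝ) :
    (∫ s in Ioi l, log (1 + exp (-s))) + ∫ s in Ioi (-l), log (1 + exp (-s))
      = π ^ 2 / 6 + l ^ 2 / 2 := by
  set f : ℝ → ℝ := fun s => log (1 + exp (-s)) with hf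
  have hi := integrableOn_log_one_add_exp_neg
  have h1 := intervalIntegral.integral_interval_add_Ioi (hi 0) (hi l)
  have h2 := intervalIntegral.integral_interval_add_Ioi (hi (-l)) (hi 0)
  have h3 : ∫ s in (-l)..0, f s = ∫ s in (0 : ℝ)..l, f (-s) := by
    rw [intervalIntegral.integral_comp_neg]
    simp
  have h4 (s : ℝ) : f (-s) = f s + s := by
    simp only [hf, neg_neg]
    have : 1 + exp s = exp s * (1 + exp (-s)) := by
      rw [mul_add, ← exp_add]
      simp [add_comm]
    rw [this, log_mul (exp_pos _).ne' (by positivity), log_exp]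
    ring
  have h5 : ∫ s in (0 : ℝ)..l, f (-s) = (∫ s in (0 : ℝ)..l, f s) + l ^ 2 / 2 := by
    simp only [h4]
    rw [intervalIntegral.integral_add (f := f) (g := fun s => s)
      (continuous_log_one_add_exp_neg.intervalIntegrable _ _)
      (continuous_id.intervalIntegrable _ _)]
    simp
  have h6 := integral_log_one_add_exp_neg.2
  simp only [← hf] at h1 h2 h6 ⊢
  linarith

/-- The length of the slices of an ideal triangle in logarithmic coordinates. -/
noncomputable def sliceLength (l s : ℝ) : ℝ :=
  Real.log (1 + Real.exp (-(s + l))) - Real.log (1 - Real.exp (-s))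

open Set Real in
theorem sliceLength_nonneg {s : ℝ} (l : ℝ) (hs : 0 < s) : 0 ≤ sliceLength l s := by
  have h1 : 0 ≤ log (1 + exp (-(s + l))) := log_nonneg (by linarith [exp_pos (-(s + l))])
  have h2 : log (1 - exp (-s)) ≤ 0 := by
    have := exp_lt_one_iff.2 (neg_lt_zero.2 hs)
    exact log_nonpos (by linarith) (by linarith [exp_pos (-s)])
  unfold sliceLength
  linarith

open Set Real in
theorem integral_sliceLength (l : ℝ) :
    IntegrableOn (sliceLength l) (Ioi 0) ∧
      ∫ s in Ioi (0 : ℝ), sliceLength l s = (∫ s in Ioi l, log (1 + exp (-s))) + π ^ 2 / 6 := by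
  obtain ⟨h1, h2⟩ := integral_neg_log_one_sub_exp_neg
  have hp : (fun s : ℝ => s + l) ⁻¹' Ioi l = Ioi 0 := by
    ext s
    simp
  have hm := measurePreserving_add_right (volume : Measure ℝ) l
  have he := (MeasurableEquiv.addRight l).measurableEmbedding
  have h3 : IntegrableOn (fun s : ℝ => log (1 + exp (-(s + l)))) (Ioi 0) := by
    rw [← hp]
    exact (hm.integrableOn_comp_preimage he).2 (integrableOn_log_one_add_exp_neg l)
  have h4 : ∫ s in Ioi (0 : ℝ), log (1 + exp (-(s + l))) = ∫ s in Ioi l, log (1 + exp (-s)) := by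
    rw [← hp]
    exact hm.setIntegral_preimage_emb he (fun s => log (1 + exp (-s))) (Ioi l)
  have h5 : sliceLength l = fun s => log (1 + exp (-(s + l))) + -log (1 - exp (-s)) := by
    ext s
    rw [sliceLength, sub_eq_add_neg]
  rw [h5]
  refine ⟨h3.add h1, ?_⟩
  rw [integral_add h3 h1, h2, h4]

open Set Real in
theorem lintegral_sliceLength_add (l : ℝ) :
    (∫⁻ s in Ioi (0 : ℝ), ENNReal.ofReal (sliceLength l s))
        + ∫⁻ s in Ioi (0 : ℝ), ENNReal.ofReal (sliceLength (-l) s)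
      = ENNReal.ofReal ((π ^ 2 + l ^ 2) / 2) := by
  have key (k : ℝ) : ∫⁻ s in Ioi (0 : ℝ), ENNReal.ofReal (sliceLength k s)
      = ENNReal.ofReal (∫ s in Ioi (0 : ℝ), sliceLength k s) := by
    rw [ofReal_integral_eq_lintegral_ofReal (integral_sliceLength k).1]
    exact (ae_restrict_mem measurableSet_Ioi).mono fun s hs => sliceLength_nonneg k hs
  have hn (k : ℝ) : 0 ≤ ∫ s in Ioi (0 : ℝ), sliceLength k s :=
    setIntegral_nonneg measurableSet_Ioi fun s hs => sliceLength_nonneg k hs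
  rw [key, key, ← ENNReal.ofReal_add (hn _) (hn _), (integral_sliceLength l).2,
    (integral_sliceLength (-l)).2]
  congr 1
  linarith [integral_log_one_add_exp_neg_Ioi_add l]

/-! ### The Lebesgue measure of the ideal triangle in logarithmic coordinates -/

/-- The open cone over the interior of the standard triangle, intersected with the cone spanned by
`(1, a, 0)`, `(0, 1, b)` and `(c, 0, 1)`. -/
def triangleCone (a b c : ℝ) : Set (Fin 3 → ℝ) :=
  {y | (∀ i, 0 < y i) ∧ c * y 2 ≤ y 0 + b * c * y 1 ∧ a * y 0 ≤ y 1 + c * a * y 2 ∧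
    b * y 1 ≤ y 2 + a * b * y 0}

/-- The projectivization of `triangleCone a b c` in logarithmic coordinates. -/
def logTriangle (a b c : ℝ) : Set (Fin 2 → ℝ) :=
  {p | ![1, Real.exp (p 0), Real.exp (p 1)] ∈ triangleCone a b c}

theorem mem_logTriangle {a b c : ℝ} {p : Fin 2 → ℝ} :
    p ∈ logTriangle a b c ↔ c * Real.exp (p 1) ≤ 1 + b * c * Real.exp (p 0) ∧
      a ≤ Real.exp (p 0) + c * a * Real.exp (p 1) ∧
      b * Real.exp (p 0) ≤ Real.exp (p 1) + a * b := by
  simp [logTriangle, triangleCone, Fin.forall_fin_succ, Real.exp_pos]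

theorem measurableSet_logTriangle (a b c : ℝ) : MeasurableSet (logTriangle a b c) := by
  have : logTriangle a b c = {p | c * Real.exp (p 1) ≤ 1 + b * c * Real.exp (p 0)} ∩
      ({p | a ≤ Real.exp (p 0) + c * a * Real.exp (p 1)} ∩
        {p | b * Real.exp (p 0) ≤ Real.exp (p 1) + a * b}) := by
    ext p
    exact mem_logTriangle
  rw [this]
  refine (IsClosed.inter ?_ (IsClosed.inter ?_ ?_)).measurableSet
  all_goals exact isClosed_le (by fun_prop) (by fun_prop)

-- The redundant lower bound `k` is carried along because two sides of the triangle bound a slice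
-- from below, and the position of the slice decides which of them is active.
open Real Set in
theorem volume_setOf_log_le_le {c k l u : ℝ} (hc : 0 < c) (hl : 0 < l) (hu : 0 < u) (hk : k ≤ l) :
    volume {y : ℝ | c * exp y ≤ u ∧ l ≤ c * exp y ∧ k ≤ c * exp y}
      = ENNReal.ofReal (log u - log l) := by
  have : {y : ℝ | c * exp y ≤ u ∧ l ≤ c * exp y ∧ k ≤ c * exp y}
      = Icc (log l - log c) (log u - log c) := by
    ext y
    have h : exp (log c + y) = c * exp y := by rw [exp_add, exp_log hc]
    have h1 : c * exp y ≤ u ↔ y ≤ log u - log c := by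
      rw [← h, ← le_log_iff_exp_le hu, le_sub_iff_add_le']
    have h2 : l ≤ c * exp y ↔ log l - log c ≤ y := by
      rw [← h, ← log_le_iff_le_exp hl, sub_le_iff_le_add']
    simp only [mem_ofPred_eq, mem_Icc, ← h1, ← h2]
    constructor
    · rintro ⟨h3, h4, -⟩
      exact ⟨h4, h3⟩
    · rintro ⟨h3, h4⟩
      exact ⟨h4, h3, hk.trans h3⟩
  rw [this, volume_Icc]
  congr 1
  ring

-- The shift by `log a` moves the slice through the vertex `(1, a, 0)` to `s = 0`, where the length
-- is infinite. In terms of `exp s` and `c * exp y` the three sides depend only on `t = a * b * c`.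
-- The active lower bound is `1 - exp s` for `s < 0` and `t * (exp s - 1)` for `s > 0`; the two
-- cases are exchanged by `s ↦ -s`, `log t ↦ -log t`.
open Real Set in
theorem volume_logTriangle_slice {a b c : ℝ} (ha : 0 < a) (hb : 0 < b) (hc : 0 < c) {s : ℝ}
    (hs : s ≠ 0) :
    volume {y : ℝ | ![s + log a, y] ∈ logTriangle a b c}
      = if s < 0 then ENNReal.ofReal (sliceLength (-log (a * b * c)) (-s))
        else ENNReal.ofReal (sliceLength (log (a * b * c)) s) := by
  have ht : 0 < a * b * c := by positivity
  set t := a * b * c with htd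
  have hE := exp_pos s
  have hset : {y : ℝ | ![s + log a, y] ∈ logTriangle a b c}
      = {y : ℝ | c * exp y ≤ 1 + t * exp s ∧ 1 - exp s ≤ c * exp y ∧
          t * (exp s - 1) ≤ c * exp y} := by
    ext y
    simp only [mem_ofPred_eq, mem_logTriangle, Matrix.cons_val_zero, Matrix.cons_val_one,
      exp_add, exp_log ha]
    refine and_congr ?_ (and_congr ?_ ?_)
    · rw [htd]
      constructor <;> intro h <;> linarith
    · rw [← mul_le_mul_iff_right₀ ha (b := 1 - exp s)]
      constructor <;> intro h <;> linarith
    · rw [← mul_le_mul_iff_right₀ hc, htd]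
      constructor <;> intro h <;> linarith
  rw [hset]
  have hu : 0 < 1 + t * exp s := by positivity
  rcases lt_or_gt_of_ne hs with h | h
  · have h1 : exp s < 1 := by simpa using h
    rw [if_pos h, volume_setOf_log_le_le hc (by linarith) hu (by nlinarith), sliceLength]
    congr 4
    · rw [show -(-s + -log t) = log t + s by ring, exp_add, exp_log ht]
    · rw [neg_neg]
  · have h1 : 1 < exp s := by simpa using h
    have h2 : 0 < t * (exp s - 1) := mul_pos ht (by linarith)
    have h3 : {y : ℝ | c * exp y ≤ 1 + t * exp s ∧ 1 - exp s ≤ c * exp y ∧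
          t * (exp s - 1) ≤ c * exp y} = {y : ℝ | c * exp y ≤ 1 + t * exp s ∧
          t * (exp s - 1) ≤ c * exp y ∧ 1 - exp s ≤ c * exp y} := by
      ext y
      simp only [mem_ofPred_eq]
      tauto
    rw [if_neg h.not_gt, h3, volume_setOf_log_le_le hc h2 hu (by linarith), sliceLength,
      ← log_div hu.ne' h2.ne', ← log_div (by positivity)
        (by simpa [sub_eq_zero] using (Real.exp_lt_one_iff.2 (neg_lt_zero.2 h)).ne')]
    congr 2
    rw [show -(s + log t) = -s + -log t by ring, exp_add, exp_neg s, exp_neg (log t), exp_log ht]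
    have : exp s - 1 ≠ 0 := by linarith
    have h4 : 1 - (exp s)⁻¹ ≠ 0 := by
      rw [show 1 - (exp s)⁻¹ = (exp s - 1) / exp s by field_simp]
      positivity
    field_simp
    ring

open Real Set in
theorem volume_logTriangle {a b c : ℝ} (ha : 0 < a) (hb : 0 < b) (hc : 0 < c) :
    volume (logTriangle a b c) = ENNReal.ofReal ((π ^ 2 + log (a * b * c) ^ 2) / 2) := by
  set l := log (a * b * c) with hl
  have hmp := (volume_preserving_finTwoArrow ℝ).symm
  have hm := measurableSet_logTriangle a b c
  rw [← hmp.measure_preimage hm.nullMeasurableSet, Measure.volume_eq_prod,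
    Measure.prod_apply (hmp.measurable hm)]
  have h1 (x : ℝ) : volume (Prod.mk x ⁻¹' (MeasurableEquiv.finTwoArrow.symm ⁻¹' logTriangle a b c))
      = volume {y : ℝ | ![x, y] ∈ logTriangle a b c} := rfl
  simp only [h1]
  rw [← lintegral_add_right_eq_self _ (log a)]
  have h2 : ∀ᵐ s : ℝ, volume {y : ℝ | ![s + log a, y] ∈ logTriangle a b c}
      = if s < 0 then ENNReal.ofReal (sliceLength (-l) (-s))
        else ENNReal.ofReal (sliceLength l s) := by
    have : ∀ᵐ s : ℝ, s ≠ 0 := by simp [ae_iff]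
    filter_upwards [this] with s hs
    exact volume_logTriangle_slice ha hb hc hs
  rw [lintegral_congr_ae h2, ← lintegral_sliceLength_add, add_comm,
    ← lintegral_add_compl _ (measurableSet_Iio (a := (0 : ℝ)))]
  congr 1
  · refine (setLIntegral_congr_fun (g := fun s => ENNReal.ofReal (sliceLength (-l) (-s)))
      measurableSet_Iio fun s hs => if_pos hs).trans ?_
    have := (Measure.measurePreserving_neg (volume : Measure ℝ)).setLIntegral_comp_preimage_emb
      (MeasurableEquiv.neg ℝ).measurableEmbedding
      (fun s => ENNReal.ofReal (sliceLength (-l) s)) (Ioi 0)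
    rw [← this]
    simp
  · rw [compl_Iio]
    refine (setLIntegral_congr_fun (g := fun s => ENNReal.ofReal (sliceLength l s))
      measurableSet_Ici fun s hs => if_neg (not_lt.2 hs)).trans ?_
    exact setLIntegral_congr Ioi_ae_eq_Ici.symm

/-! ### Parallelogram measures and gauges -/

theorem volume_parallelepiped_pair (a b : Fin 2 → ℝ) :
    volume (parallelepiped ![a, b]) = ENNReal.ofReal |a 0 * b 1 - a 1 * b 0| := by
  have h : (Pi.basisFun ℝ (Fin 2)).addHaar = volume := by
    rw [Module.Basis.addHaar, Module.Basis.parallelepiped_basisFun, addHaarMeasure_eq_volume_pi]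
  rw [← h, Measure.addHaar_parallelepiped]
  congr 2
  rw [Module.Basis.det_apply, Matrix.det_fin_two]
  simp [Module.Basis.toMatrix_apply]
  ring

theorem det_mul_pair (A : (Fin 2 → ℝ) →L[ℝ] (Fin 2 → ℝ)) (a b : Fin 2 → ℝ) :
    A a 0 * A b 1 - A a 1 * A b 0 = A.det * (a 0 * b 1 - a 1 * b 0) := by
  have h := (Pi.basisFun ℝ (Fin 2)).det_comp (A : (Fin 2 → ℝ) →ₗ[ℝ] (Fin 2 → ℝ)) ![a, b]
  rw [Module.Basis.det_apply, Module.Basis.det_apply, Matrix.det_fin_two, Matrix.det_fin_two] at h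
  simp only [Module.Basis.toMatrix_apply, Pi.basisFun_repr, Function.comp_apply,
    Matrix.cons_val_zero, Matrix.cons_val_one, ContinuousLinearMap.coe_coe] at h
  rw [ContinuousLinearMap.det]
  linarith

/-- Parallelograms may be measured after applying `A`, which multiplies areas by `|A.det|`. In the
application `A` is the derivative of the logarithmic chart, so that the density is compared with the
Jacobian. -/
theorem le_pAreaDensity {N : (Fin 2 → ℝ) → ℝ} {A : (Fin 2 → ℝ) →L[ℝ] (Fin 2 → ℝ)}
    (hA : A.det ≠ 0) {M : ℝ} (hM : 0 < M)
    (h : ∀ a b, N a ≤ 1 → N b ≤ 1 → |A a 0 * A b 1 - A a 1 * A b 0| ≤ M) :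
    ENNReal.ofReal (|A.det| / M) ≤ pAreaDensity N := by
  have hA' := abs_pos.2 hA
  rw [pAreaDensity, ← inv_div, ENNReal.ofReal_inv_of_pos (by positivity), ENNReal.inv_le_inv]
  refine iSup_le fun a => iSup_le fun b => iSup_le fun ha => iSup_le fun hb => ?_
  rw [volume_parallelepiped_pair]
  refine ENNReal.ofReal_le_ofReal ?_
  rw [le_div_iff₀ hA', mul_comm, ← abs_mul, ← det_mul_pair]
  exact h a b ha hb

theorem pAreaDensity_le {N : (Fin 2 → ℝ) → ℝ} {A : (Fin 2 → ℝ) →L[ℝ] (Fin 2 → ℝ)}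
    (hA : A.det ≠ 0) {M : ℝ} (hM : 0 < M) {a b : Fin 2 → ℝ} (ha : N a ≤ 1) (hb : N b ≤ 1)
    (h : M ≤ |A a 0 * A b 1 - A a 1 * A b 0|) :
    pAreaDensity N ≤ ENNReal.ofReal (|A.det| / M) := by
  have hA' := abs_pos.2 hA
  rw [pAreaDensity, ← inv_div, ENNReal.ofReal_inv_of_pos (by positivity), ENNReal.inv_le_inv]
  refine le_iSup_of_le a (le_iSup_of_le b (le_iSup_of_le ha (le_iSup_of_le hb ?_)))
  rw [volume_parallelepiped_pair]
  refine ENNReal.ofReal_le_ofReal ?_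
  rwa [div_le_iff₀ hA', mul_comm, ← abs_mul, ← det_mul_pair]

/-- A ray from `x` leaves `D` no later than it reaches a zero of an affine function `k` that is
positive on `D`. -/
theorem neg_div_le_gauge {D : Set (Fin 2 → ℝ)} (hD : IsOpen D) {x : Fin 2 → ℝ} (hx : x ∈ D)
    {k : (Fin 2 → ℝ) → ℝ} {k' : (Fin 2 → ℝ) → ℝ} (hk : ∀ r u, k (x + r • u) = k x + r * k' u)
    (hpos : ∀ z ∈ D, 0 < k z) (u : Fin 2 → ℝ) :
    -(k' u / k x) ≤ gauge {z | x + z ∈ D} u := by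
  have habs : Absorbent ℝ {z | x + z ∈ D} := by
    refine absorbent_nhds_zero ((hD.preimage (continuous_const_add x)).mem_nhds ?_)
    simpa using hx
  refine le_of_forall_gt fun G hG => ?_
  obtain ⟨r, hr, hrG, z, hz, rfl⟩ := exists_lt_of_gauge_lt habs hG
  refine lt_of_le_of_lt ?_ hrG
  have h1 : 0 < k (x + z) := hpos _ hz
  have h2 := hk r⁻¹ (r • z)
  rw [inv_smul_smul₀ hr.ne'] at h2
  change -(k' (r • z) / k x) ≤ r
  have hkx := hpos x hx
  rw [h2] at h1
  rw [← neg_div, div_le_iff₀ hkx]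
  have h3 : 0 < r * (k x + r⁻¹ * k' (r • z)) := mul_pos hr h1
  rw [mul_add, mul_inv_cancel_left₀ hr.ne'] at h3
  linarith

/-- Monotonicity of the Hilbert norm in elementary form: `k` limits the chord in the direction `-u`
and `l` limits it in the direction `u`. -/
theorem sub_le_two_mul_hilbertNorm {D : Set (Fin 2 → ℝ)} (hD : IsOpen D) {x : Fin 2 → ℝ}
    (hx : x ∈ D) {k l : (Fin 2 → ℝ) → ℝ} {k' l' : (Fin 2 → ℝ) →ₗ[ℝ] ℝ}
    (hk : ∀ r u, k (x + r • u) = k x + r * k' u) (hkpos : ∀ z ∈ D, 0 < k z)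
    (hl : ∀ r u, l (x + r • u) = l x + r * l' u) (hlpos : ∀ z ∈ D, 0 < l z) (u : Fin 2 → ℝ) :
    k' u / k x - l' u / l x ≤ 2 * hilbertNorm D x u := by
  have h1 := neg_div_le_gauge hD hx hk hkpos (-u)
  have h2 := neg_div_le_gauge hD hx hl hlpos u
  rw [map_neg, neg_div, neg_neg] at h1
  rw [hilbertNorm]
  linarith

/-- For `p, p' ≥ 0` the extreme choices `q' = 2`, `q = p - 2` give `2 p + 2 p' - p p'`, which for `m
≤ 2` is largest at `p = p' = m`. The other signs are similar. For `0 ≤ m` the pair `(m, 2)`, `(m, m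
- 2)` attains the bound. -/
theorem abs_det_le_of_mem_hexagon {m p q p' q' : ℝ} (hm : m ≤ 2) (hp : |p| ≤ m)
    (hp' : |p'| ≤ m) (hq : |q| ≤ 2) (hq' : |q'| ≤ 2) (h : |p - q| ≤ 2) (h' : |p' - q'| ≤ 2) :
    |p * q' - q * p'| ≤ m * (4 - m) := by
  rw [abs_le] at *
  have key {x y : ℝ} (hx : 0 ≤ x) (hy : 0 ≤ y) (hxm : x ≤ m) (hym : y ≤ m) :
      2 * x + 2 * y - x * y ≤ m * (4 - m) := by
    nlinarith [mul_nonneg (sub_nonneg.2 hxm) (by linarith : 0 ≤ 2 - y),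
      mul_nonneg (sub_nonneg.2 hym) (by linarith : 0 ≤ 2 - m)]
  rcases le_total 0 p with h0 | h0 <;> rcases le_total 0 p' with h0' | h0'
  · have := key h0 h0' hp.2 hp'.2
    constructor <;> nlinarith
  · have := key h0 (neg_nonneg.2 h0') hp.2 (by linarith)
    constructor <;> nlinarith
  · have := key (neg_nonneg.2 h0) h0' (by linarith) hp'.2
    constructor <;> nlinarith
  · have := key (neg_nonneg.2 h0) (neg_nonneg.2 h0') (by linarith) (by linarith)
    constructor <;> nlinarith

/-! ### Logarithmic coordinates of a triangle in an affine chart -/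

/-- The vector representing the point with coordinates `x` in the affine chart `e`. -/
noncomputable def affineVec (e : Frame) (x : Fin 2 → ℝ) : Fin 3 → ℝ :=
  x 0 • e 0 + x 1 • e 1 + e 2

/-- The linear part of `affineVec`. -/
noncomputable def affineDir (e : Frame) : (Fin 2 → ℝ) →ₗ[ℝ] (Fin 3 → ℝ) where
  toFun u := u 0 • e 0 + u 1 • e 1
  map_add' u u' := by
    simp only [Pi.add_apply, add_smul]
    abel
  map_smul' r u := by
    simp only [Pi.smul_apply, smul_eq_mul, mul_smul, smul_add, RingHom.id_apply]

theorem affineVec_eq (e : Frame) (x : Fin 2 → ℝ) : affineVec e x = affineDir e x + e 2 := rfl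

theorem affineVec_add_smul (e : Frame) (x : Fin 2 → ℝ) (r : ℝ) (u : Fin 2 → ℝ) :
    affineVec e (x + r • u) = affineVec e x + r • affineDir e u := by
  rw [affineVec_eq, affineVec_eq, map_add, map_smul]
  abel

@[simp]
theorem repr_affineVec_two (e : Frame) (x : Fin 2 → ℝ) : e.repr (affineVec e x) 2 = 1 := by
  simp [affineVec]

@[simp]
theorem repr_affineDir_two (e : Frame) (u : Fin 2 → ℝ) : e.repr (affineDir e u) 2 = 0 := by
  simp [affineDir]

theorem affineDir_injective (e : Frame) : Function.Injective (affineDir e) := by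
  rw [← LinearMap.ker_eq_bot, LinearMap.ker_eq_bot']
  intro u hu
  have h0 := congrArg (fun z => e.repr z 0) hu
  have h1 := congrArg (fun z => e.repr z 1) hu
  ext j
  fin_cases j
  · simpa [affineDir] using h0
  · simpa [affineDir] using h1

theorem affineVec_injective (e : Frame) : Function.Injective (affineVec e) := by
  intro x y h
  exact affineDir_injective e (add_right_cancel h)

theorem eq_of_affineVec_eq_smul {e : Frame} {x y : Fin 2 → ℝ} {r : ℝ}
    (h : affineVec e x = r • affineVec e y) : x = y := by
  have h2 := congrArg (fun z => e.repr z 2) h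
  simp only [repr_affineVec_two, map_smul, Finsupp.smul_apply, smul_eq_mul, mul_one] at h2
  rw [← h2, one_smul] at h
  exact affineVec_injective e h

theorem continuous_affineVec (e : Frame) : Continuous (affineVec e) := by
  unfold affineVec
  fun_prop

theorem exists_affineVec_eq (e : Frame) {z : Fin 3 → ℝ} (hz : e.repr z 2 ≠ 0) :
    ∃ x, affineVec e x = (e.repr z 2)⁻¹ • z := by
  refine ⟨![(e.repr z 2)⁻¹ * e.repr z 0, (e.repr z 2)⁻¹ * e.repr z 1], e.repr.injective ?_⟩
  ext i
  fin_cases i <;> simp [affineVec, hz]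

/-- The coordinates of the point `x` of the affine chart `e` with respect to the basis `v`. -/
noncomputable def chartCoord (e v : Frame) (x : Fin 2 → ℝ) (i : Fin 3) : ℝ :=
  v.repr (affineVec e x) i

/-- The linear part of `chartCoord`. -/
noncomputable def chartCoordDir (e v : Frame) (i : Fin 3) : (Fin 2 → ℝ) →L[ℝ] ℝ :=
  LinearMap.toContinuousLinearMap (v.coord i ∘ₗ affineDir e)

theorem chartCoordDir_apply (e v : Frame) (i : Fin 3) (u : Fin 2 → ℝ) :
    chartCoordDir e v i u = v.repr (affineDir e u) i := rfl

theorem chartCoord_add_smul (e v : Frame) (x : Fin 2 → ℝ) (i : Fin 3) (r : ℝ) (u : Fin 2 → ℝ) :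
    chartCoord e v (x + r • u) i = chartCoord e v x i + r * chartCoordDir e v i u := by
  simp [chartCoord, affineVec_add_smul, chartCoordDir_apply]

theorem hasFDerivAt_chartCoord (e v : Frame) (i : Fin 3) (x : Fin 2 → ℝ) :
    HasFDerivAt (fun x => chartCoord e v x i) (chartCoordDir e v i) x := by
  have : (fun x => chartCoord e v x i) = fun x => chartCoordDir e v i x + v.repr (e 2) i := by
    ext x
    simp [chartCoord, affineVec_eq, chartCoordDir_apply]
  rw [this]
  exact (chartCoordDir e v i).hasFDerivAt.add_const _

theorem continuous_chartCoord (e v : Frame) (i : Fin 3) :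
    Continuous fun x => chartCoord e v x i :=
  continuous_iff_continuousAt.2 fun x => (hasFDerivAt_chartCoord e v i x).continuousAt

/-- The logarithmic coordinates `(log (y₁ / y₀), log (y₂ / y₀))`, where the `yᵢ` are the
coordinates with respect to `v`. -/
noncomputable def logChart (e v : Frame) (x : Fin 2 → ℝ) : Fin 2 → ℝ := fun j =>
  Real.log (chartCoord e v x j.succ) - Real.log (chartCoord e v x 0)

/-- The derivative of `logChart`. -/
noncomputable def logChartDeriv (e v : Frame) (x : Fin 2 → ℝ) :
    (Fin 2 → ℝ) →L[ℝ] (Fin 2 → ℝ) :=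
  ContinuousLinearMap.pi fun j => (chartCoord e v x j.succ)⁻¹ • chartCoordDir e v j.succ -
    (chartCoord e v x 0)⁻¹ • chartCoordDir e v 0

theorem logChartDeriv_apply (e v : Frame) (x u : Fin 2 → ℝ) (j : Fin 2) :
    logChartDeriv e v x u j = chartCoordDir e v j.succ u / chartCoord e v x j.succ -
      chartCoordDir e v 0 u / chartCoord e v x 0 := by
  simp only [logChartDeriv, ContinuousLinearMap.coe_pi', FunLike.coe_sub,
    FunLike.coe_smul, Pi.sub_apply, Pi.smul_apply, smul_eq_mul]
  ring

theorem hasFDerivAt_logChart {e v : Frame} {x : Fin 2 → ℝ} (hx : ∀ i, 0 < chartCoord e v x i) :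
    HasFDerivAt (logChart e v) (logChartDeriv e v x) x := by
  rw [hasFDerivAt_pi']
  intro j
  exact ((hasFDerivAt_chartCoord e v j.succ x).log (hx _).ne').sub
    ((hasFDerivAt_chartCoord e v 0 x).log (hx _).ne')

theorem exp_logChart {e v : Frame} {x : Fin 2 → ℝ} (hx : ∀ i, 0 < chartCoord e v x i)
    (j : Fin 2) :
    Real.exp (logChart e v x j) = chartCoord e v x j.succ / chartCoord e v x 0 := by
  rw [logChart, Real.exp_sub, Real.exp_log (hx _), Real.exp_log (hx _)]

theorem injOn_logChart (e v : Frame) :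
    Set.InjOn (logChart e v) {x | ∀ i, 0 < chartCoord e v x i} := by
  intro x hx y hy h
  refine eq_of_affineVec_eq_smul (e := e) (r := chartCoord e v x 0 / chartCoord e v y 0)
    (v.repr.injective ?_)
  have h0 := (hy 0).ne'
  have key (j : Fin 2) : chartCoord e v x j.succ
      = chartCoord e v x 0 / chartCoord e v y 0 * chartCoord e v y j.succ := by
    have h1 := exp_logChart hx j
    rw [h, exp_logChart hy j, div_eq_div_iff h0 (hx 0).ne'] at h1
    field_simp
    linarith
  ext i
  rw [map_smul, Finsupp.smul_apply, smul_eq_mul]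
  induction i using Fin.cases with
  | zero => exact (div_mul_cancel₀ _ h0).symm
  | succ j => exact key j

/-- Along a vector of the kernel all three coordinates have the same logarithmic derivative, so that
its direction in `ℝ³` is a multiple of the point itself. The last chart coordinate is 0 for the
former and 1 for the latter. -/
theorem det_logChartDeriv_ne_zero {e v : Frame} {x : Fin 2 → ℝ}
    (hx : ∀ i, 0 < chartCoord e v x i) : (logChartDeriv e v x).det ≠ 0 := by
  rw [ContinuousLinearMap.det, ← isUnit_iff_ne_zero, ← LinearMap.isUnit_iff_isUnit_det,
    LinearMap.isUnit_iff_ker_eq_bot, LinearMap.ker_eq_bot']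
  intro u hu
  set r := chartCoordDir e v 0 u / chartCoord e v x 0 with hr
  have h0 := (hx 0).ne'
  have key (i : Fin 3) : chartCoordDir e v i u = r * chartCoord e v x i := by
    induction i using Fin.cases with
    | zero => rw [hr, div_mul_cancel₀ _ h0]
    | succ j =>
      have h1 : logChartDeriv e v x u j = 0 := congrFun hu j
      rw [logChartDeriv_apply, sub_eq_zero, div_eq_iff (hx _).ne'] at h1
      exact h1
  have h2 : affineDir e u = r • affineVec e x := by
    refine v.repr.injective ?_
    ext i
    rw [map_smul, Finsupp.smul_apply, smul_eq_mul]
    exact key i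
  have h3 := congrArg (fun z => e.repr z 2) h2
  simp only [repr_affineDir_two, map_smul, Finsupp.smul_apply, repr_affineVec_two, smul_eq_mul,
    mul_one] at h3
  rw [← h3, zero_smul] at h2
  exact affineDir_injective e (by rw [h2, map_zero])

theorem volume_image_logChart {e v : Frame} {S : Set (Fin 2 → ℝ)} (hS : MeasurableSet S)
    (hpos : ∀ x ∈ S, ∀ i, 0 < chartCoord e v x i) :
    volume (logChart e v '' S) = ∫⁻ x in S, ENNReal.ofReal |(logChartDeriv e v x).det| := by
  have := lintegral_image_eq_lintegral_abs_det_fderiv_mul volume hS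
    (fun x hx => (hasFDerivAt_logChart (hpos x hx)).hasFDerivWithinAt)
    ((injOn_logChart e v).mono hpos) (fun _ => 1)
  simpa using this

/-- These are the inequalities `k'/k - l'/l ≤ 2` for all pairs of the three coordinates; they cut
out the hexagon. -/
theorem abs_logChartDeriv_le {e v : Frame} {D : Set (Fin 2 → ℝ)} (hD : IsOpen D)
    (hpos : ∀ x ∈ D, ∀ i, 0 < chartCoord e v x i) {x u : Fin 2 → ℝ} (hx : x ∈ D)
    (hu : hilbertNorm D x u ≤ 1) :
    |logChartDeriv e v x u 0| ≤ 2 ∧ |logChartDeriv e v x u 1| ≤ 2 ∧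
      |logChartDeriv e v x u 0 - logChartDeriv e v x u 1| ≤ 2 := by
  have key (i j : Fin 3) : chartCoordDir e v i u / chartCoord e v x i -
      chartCoordDir e v j u / chartCoord e v x j ≤ 2 := by
    have := sub_le_two_mul_hilbertNorm hD hx (k' := (chartCoordDir e v i).toLinearMap)
      (l' := (chartCoordDir e v j).toLinearMap) (chartCoord_add_smul e v x i)
      (fun z hz => hpos z hz i) (chartCoord_add_smul e v x j) (fun z hz => hpos z hz j) u
    simp only [ContinuousLinearMap.coe_coe] at this
    linarith
  simp only [logChartDeriv_apply]
  simp only [abs_le]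
  refine ⟨⟨?_, ?_⟩, ⟨?_, ?_⟩, ?_, ?_⟩
  · linarith [key 0 (Fin.succ 0)]
  · linarith [key (Fin.succ 0) 0]
  · linarith [key 0 (Fin.succ 1)]
  · linarith [key (Fin.succ 1) 0]
  · linarith [key (Fin.succ 1) (Fin.succ 0)]
  · linarith [key (Fin.succ 0) (Fin.succ 1)]

/-- A lower bound for the Hilbert area of a set in whose points the unit balls of the Hilbert norm
are contained in a hexagon cut off by two parallel lines. -/
theorem mul_volume_image_logChart_le {e v : Frame} {D S : Set (Fin 2 → ℝ)} (hD : IsOpen D)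
    (hpos : ∀ x ∈ D, ∀ i, 0 < chartCoord e v x i) (hSD : S ⊆ D) (hS : MeasurableSet S) {m : ℝ}
    (hm0 : 0 < m) (hm : m ≤ 2)
    (h : ∀ x ∈ S, ∀ u, hilbertNorm D x u ≤ 1 → |logChartDeriv e v x u 0| ≤ m) :
    ENNReal.ofReal (m * (4 - m))⁻¹ * volume (logChart e v '' S)
      ≤ ∫⁻ x in S, pAreaDensity (hilbertNorm D x) := by
  have hM : 0 < m * (4 - m) := mul_pos hm0 (by linarith)
  rw [volume_image_logChart hS fun x hx => hpos x (hSD hx), ← lintegral_const_mul']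
  swap
  · exact ENNReal.ofReal_ne_top
  refine setLIntegral_mono' hS fun x hx => ?_
  rw [← ENNReal.ofReal_mul (by positivity), mul_comm, ← div_eq_mul_inv]
  refine le_pAreaDensity (det_logChartDeriv_ne_zero (hpos x (hSD hx))) hM fun a b ha hb => ?_
  obtain ⟨-, h2, h3⟩ := abs_logChartDeriv_le hD hpos (hSD hx) ha
  obtain ⟨-, h2', h3'⟩ := abs_logChartDeriv_le hD hpos (hSD hx) hb
  exact abs_det_le_of_mem_hexagon hm (h x hx a ha) (h x hx b hb) h2 h2' h3 h3'

/-! ### Area estimates for ideal triangles in a chart -/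

/-- The part of the chart `e` which is covered by the ideal triangle with parameters `a, b, c` in
the triangle `v`. -/
def chartTriangle (e v : Frame) (a b c : ℝ) : Set (Fin 2 → ℝ) :=
  {x | chartCoord e v x ∈ triangleCone a b c}

theorem measurableSet_chartTriangle (e v : Frame) (a b c : ℝ) :
    MeasurableSet (chartTriangle e v a b c) := by
  have hc := continuous_chartCoord e v
  have : chartTriangle e v a b c = (⋂ i, {x | 0 < chartCoord e v x i}) ∩
      ({x | c * chartCoord e v x 2 ≤ chartCoord e v x 0 + b * c * chartCoord e v x 1} ∩
      ({x | a * chartCoord e v x 0 ≤ chartCoord e v x 1 + c * a * chartCoord e v x 2} ∩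
      {x | b * chartCoord e v x 1 ≤ chartCoord e v x 2 + a * b * chartCoord e v x 0})) := by
    ext x
    simp [chartTriangle, triangleCone]
  rw [this]
  refine (MeasurableSet.iInter fun i => (isOpen_lt continuous_const (hc i)).measurableSet).inter
    (IsClosed.inter ?_ (IsClosed.inter ?_ ?_)).measurableSet
  all_goals exact isClosed_le (by fun_prop) (by fun_prop)

theorem smul_mem_triangleCone {a b c r : ℝ} (hr : 0 < r) {y : Fin 3 → ℝ}
    (hy : y ∈ triangleCone a b c) : r • y ∈ triangleCone a b c := by
  obtain ⟨h, h0, h1, h2⟩ := hy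
  refine ⟨fun i => mul_pos hr (h i), ?_, ?_, ?_⟩ <;> simp only [Pi.smul_apply, smul_eq_mul] <;>
    nlinarith

/-- The hypothesis puts the whole triangle into the patch: a point given by logarithmic coordinates
can be rescaled to last chart coordinate 1. -/
theorem image_logChart_chartTriangle {e v : Frame} {a b c : ℝ}
    (h : ∀ z, ⇑(v.repr z) ∈ triangleCone a b c → 0 < e.repr z 2) :
    logChart e v '' chartTriangle e v a b c = logTriangle a b c := by
  ext p
  constructor
  · rintro ⟨x, hx, rfl⟩
    have h0 := hx.1 0
    convert smul_mem_triangleCone (inv_pos.2 h0) hx using 1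
    rw [logTriangle, Set.mem_ofPred_eq, exp_logChart hx.1, exp_logChart hx.1]
    congr! 1
    ext i
    fin_cases i
    · simp [h0.ne']
    · simp [div_eq_inv_mul]
    · simp [div_eq_inv_mul]
  · intro hp
    set z : Fin 3 → ℝ := v.equivFun.symm ![1, Real.exp (p 0), Real.exp (p 1)] with hz
    have hr : ⇑(v.repr z) = ![1, Real.exp (p 0), Real.exp (p 1)] :=
      v.equivFun.apply_symm_apply _
    have h2 : 0 < e.repr z 2 := h z (by rw [hr]; exact hp)
    obtain ⟨x, hx⟩ := exists_affineVec_eq e h2.ne'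
    have hc : chartCoord e v x = (e.repr z 2)⁻¹ • ![1, Real.exp (p 0), Real.exp (p 1)] := by
      ext i
      rw [chartCoord, hx, map_smul, Finsupp.smul_apply, hr]
      rfl
    have hm : x ∈ chartTriangle e v a b c := by
      change chartCoord e v x ∈ triangleCone a b c
      rw [hc]
      exact smul_mem_triangleCone (inv_pos.2 h2) hp
    refine ⟨x, hm, ?_⟩
    ext j
    refine Real.exp_injective ?_
    rw [exp_logChart hm.1, hc]
    fin_cases j <;> simp <;> field_simp

theorem volume_logTriangle_quarter {a b c : ℝ} (ha : 0 < a) (hb : 0 < b) (hc : 0 < c) :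
    ENNReal.ofReal (4⁻¹ : ℝ) * volume (logTriangle a b c)
      = ENNReal.ofReal ((Real.pi ^ 2 + Real.log (a * b * c) ^ 2) / 8) := by
  rw [volume_logTriangle ha hb hc, ← ENNReal.ofReal_mul (by norm_num)]
  congr 1
  ring

theorem quarter_volume_image_logChart_le {e v : Frame} {D S : Set (Fin 2 → ℝ)} (hD : IsOpen D)
    (hpos : ∀ x ∈ D, ∀ i, 0 < chartCoord e v x i) (hSD : S ⊆ D) (hS : MeasurableSet S) :
    ENNReal.ofReal (4⁻¹ : ℝ) * volume (logChart e v '' S)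
      ≤ ∫⁻ x in S, pAreaDensity (hilbertNorm D x) := by
  have := mul_volume_image_logChart_le hD hpos hSD hS two_pos le_rfl fun x hx u hu =>
    (abs_logChartDeriv_le hD hpos (hSD hx) hu).1
  norm_num at this ⊢
  exact this

/-- The lower bound for the area of an ideal triangle. -/
theorem le_lintegral_chartTriangle {e v : Frame} {D : Set (Fin 2 → ℝ)} (hD : IsOpen D)
    (hpos : ∀ x ∈ D, ∀ i, 0 < chartCoord e v x i) {a b c : ℝ} (ha : 0 < a) (hb : 0 < b)
    (hc : 0 < c) (hSD : chartTriangle e v a b c ⊆ D)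
    (h : ∀ z, ⇑(v.repr z) ∈ triangleCone a b c → 0 < e.repr z 2) :
    ENNReal.ofReal ((Real.pi ^ 2 + Real.log (a * b * c) ^ 2) / 8)
      ≤ ∫⁻ x in chartTriangle e v a b c, pAreaDensity (hilbertNorm D x) := by
  rw [← volume_logTriangle_quarter ha hb hc, ← image_logChart_chartTriangle h]
  exact quarter_volume_image_logChart_le hD hpos hSD (measurableSet_chartTriangle e v a b c)

/-- The lower bound is strict if a neighbourhood of the vertex `v 0` is cut off. -/
theorem lt_lintegral_chartTriangle {e v : Frame} {D : Set (Fin 2 → ℝ)} (hD : IsOpen D)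
    (hpos : ∀ x ∈ D, ∀ i, 0 < chartCoord e v x i) {a b c : ℝ} (ha : 0 < a) (hb : 0 < b)
    (hc : 0 < c) (hSD : chartTriangle e v a b c ⊆ D)
    (h : ∀ z, ⇑(v.repr z) ∈ triangleCone a b c → 0 < e.repr z 2) {ε : ℝ} (hε : 0 < ε)
    (hcut : ∀ x ∈ D, ε * chartCoord e v x 0 < chartCoord e v x 1 + chartCoord e v x 2) :
    ENNReal.ofReal ((Real.pi ^ 2 + Real.log (a * b * c) ^ 2) / 8)
      < ∫⁻ x in chartTriangle e v a b c, pAreaDensity (hilbertNorm D x) := by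
  set S := chartTriangle e v a b c with hSdef
  have hS : MeasurableSet S := measurableSet_chartTriangle e v a b c
  -- `A > a` lets `U` contain the points of the triangle near `[v₀ + a v₁]`, and `A > ε` makes `m >
  -- 1`.
  set A : ℝ := a + 1 + ε with hA
  have hA0 : 0 < A := by positivity
  set U : Set (Fin 2 → ℝ) := {x | 4 * chartCoord e v x 2 < ε * chartCoord e v x 0} ∩
    {x | chartCoord e v x 1 < A * chartCoord e v x 0} with hU
  have hcc := continuous_chartCoord e v
  have hUm : MeasurableSet U := by
    refine (IsOpen.inter ?_ ?_).measurableSet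
    all_goals exact isOpen_lt (by fun_prop) (by fun_prop)
  set m : ℝ := 2 - ε / A with hm
  have hεA : ε / A < 1 := by
    rw [div_lt_one hA0, hA]
    linarith
  have hεA0 : 0 < ε / A := by positivity
  have hbound : ∀ x ∈ S ∩ U, ∀ u, hilbertNorm D x u ≤ 1 → |logChartDeriv e v x u 0| ≤ m := by
    rintro x ⟨hxS, hx4, hxA⟩ u hu
    have hxD := hSD hxS
    have hq := (abs_logChartDeriv_le hD hpos hxD hu).2.1
    have hy0 := hpos x hxD 0
    have hy1 := hpos x hxD 1
    have hy2 := hpos x hxD 2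
    simp only [Set.mem_ofPred_eq] at hx4 hxA
    -- The affine function which cuts off `v 0`. Compared with coordinate 0, it bounds the
    -- combination `y₁ p + y₂ q` of the logarithmic components `p, q` of `u`.
    set k : (Fin 2 → ℝ) → ℝ := fun x =>
      chartCoord e v x 1 + chartCoord e v x 2 - ε * chartCoord e v x 0 with hk
    set k' : (Fin 2 → ℝ) →ₗ[ℝ] ℝ := (chartCoordDir e v 1 + chartCoordDir e v 2 -
      ε • chartCoordDir e v 0).toLinearMap with hk'
    have hk'u : k' u = chartCoordDir e v 1 u + chartCoordDir e v 2 u -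
      ε * chartCoordDir e v 0 u := rfl
    have hkk (r : ℝ) (u : Fin 2 → ℝ) : k (x + r • u) = k x + r * k' u := by
      have : k' u = chartCoordDir e v 1 u + chartCoordDir e v 2 u -
        ε * chartCoordDir e v 0 u := rfl
      rw [this]
      simp only [hk, chartCoord_add_smul]
      ring
    have hkpos : ∀ z ∈ D, 0 < k z := fun z hz => sub_pos.2 (hcut z hz)
    have hkx := hkpos x hxD
    have h1 := sub_le_two_mul_hilbertNorm hD hxD hkk hkpos
      (l' := (chartCoordDir e v 0).toLinearMap) (chartCoord_add_smul e v x 0)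
      (fun z hz => hpos z hz 0) u
    have h2 := sub_le_two_mul_hilbertNorm hD hxD
      (k' := (chartCoordDir e v 0).toLinearMap) (chartCoord_add_smul e v x 0)
      (fun z hz => hpos z hz 0) hkk hkpos u
    simp only [ContinuousLinearMap.coe_coe] at h1 h2
    have hpq : k' u / k x - chartCoordDir e v 0 u / chartCoord e v x 0
        = (chartCoord e v x 1 * logChartDeriv e v x u 0 +
            chartCoord e v x 2 * logChartDeriv e v x u 1) / k x := by
      have e1 : chartCoord e v x 1 ≠ 0 := hy1.ne'
      have e2 : chartCoord e v x 2 ≠ 0 := hy2.ne'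
      have e0 : chartCoord e v x 0 ≠ 0 := hy0.ne'
      rw [eq_div_iff hkx.ne', sub_mul, div_mul_cancel₀ _ hkx.ne', hk'u, logChartDeriv_apply,
        logChartDeriv_apply]
      simp only [hk, Fin.succ_zero_eq_one, Fin.succ_one_eq_two]
      field_simp
      ring
    have h3 : |chartCoord e v x 1 * logChartDeriv e v x u 0 +
            chartCoord e v x 2 * logChartDeriv e v x u 1| ≤ 2 * k x := by
      rw [← div_le_iff₀ hkx, ← abs_of_pos hkx, ← abs_div, ← hpq, abs_le]
      constructor <;> linarith
    -- Here `y₁ |p| ≤ 2 k + 2 y₂ = 2 y₁ + 4 y₂ - 2 ε y₀`. In `U` one has `4 y₂ < ε y₀` and `y₁ < A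
    -- y₀`, so this is at most `y₁ (2 - ε / A)`.
    have h4 : chartCoord e v x 1 * |logChartDeriv e v x u 0| ≤ chartCoord e v x 1 * m := by
      have h5 : ε / A * chartCoord e v x 1 ≤ ε * chartCoord e v x 0 := by
        rw [div_mul_eq_mul_div, div_le_iff₀ hA0]
        nlinarith
      have h6 : |chartCoord e v x 2 * logChartDeriv e v x u 1| ≤ 2 * chartCoord e v x 2 := by
        rw [abs_mul, abs_of_pos hy2]
        nlinarith
      have h7 : |chartCoord e v x 1 * logChartDeriv e v x u 0|
          ≤ 2 * k x + 2 * chartCoord e v x 2 := by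
        rw [abs_le] at *
        constructor <;> linarith
      rw [abs_mul, abs_of_pos hy1] at h7
      simp only [hk] at h7
      rw [hm]
      linarith
    exact le_of_mul_le_mul_left h4 hy1
  have hlow := mul_volume_image_logChart_le hD hpos (Set.inter_subset_left.trans hSD)
    (hS.inter hUm) (by linarith) (by linarith) hbound
  have hlow' := quarter_volume_image_logChart_le hD hpos (Set.sdiff_subset.trans hSD)
    (hS.diff hUm)
  have himg : logChart e v '' S = logTriangle a b c := image_logChart_chartTriangle h
  have hfin : volume (logTriangle a b c) ≠ ∞ := by
    rw [volume_logTriangle ha hb hc]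
    exact ENNReal.ofReal_ne_top
  have hfin1 : volume (logChart e v '' (S ∩ U)) ≠ ∞ :=
    ne_top_of_le_ne_top hfin (measure_mono (himg ▸ Set.image_mono Set.inter_subset_left))
  have hfin2 : volume (logChart e v '' (S \ U)) ≠ ∞ :=
    ne_top_of_le_ne_top hfin (measure_mono (himg ▸ Set.image_mono Set.sdiff_subset))
  have hvol : volume (logChart e v '' (S ∩ U)) ≠ 0 := by
    set O : Set (Fin 2 → ℝ) := {p | c * Real.exp (p 1) < 1 + b * c * Real.exp (p 0)} ∩
      ({p | a < Real.exp (p 0) + c * a * Real.exp (p 1)} ∩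
      ({p | b * Real.exp (p 0) < Real.exp (p 1) + a * b} ∩
      ({p | 4 * Real.exp (p 1) < ε} ∩ {p | Real.exp (p 0) < A}))) with hO
    have hOo : IsOpen O := by
      refine IsOpen.inter ?_ (IsOpen.inter ?_ (IsOpen.inter ?_ (IsOpen.inter ?_ ?_)))
      all_goals exact isOpen_lt (by fun_prop) (by fun_prop)
    have hOn : O.Nonempty := by
      -- The point `(1, a, δ)`, slightly off the vertex `(1, a, 0)`, satisfies all the strict
      -- inequalities.
      set δ : ℝ := min (ε / 8) (1 / c) with hδ
      have hδ0 : 0 < δ := by positivity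
      have h1 : δ ≤ ε / 8 := min_le_left _ _
      have h2 : c * δ ≤ 1 := by
        have : δ ≤ 1 / c := min_le_right _ _
        rw [le_div_iff₀ hc] at this
        linarith
      refine ⟨![Real.log a, Real.log δ], ?_⟩
      simp only [hO, Set.mem_inter_iff, Set.mem_ofPred_eq, Matrix.cons_val_zero,
        Matrix.cons_val_one, Real.exp_log ha, Real.exp_log hδ0]
      have h3 : 0 < b * c * a := by positivity
      have h4 : 0 < c * a * δ := by positivity
      refine ⟨by linarith, by linarith, by linarith, by linarith, by linarith⟩
    have hsub : O ⊆ logChart e v '' (S ∩ U) := by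
      rintro p ⟨h1, h2, h3, h4, h5⟩
      have hp : p ∈ logTriangle a b c := mem_logTriangle.2 ⟨le_of_lt h1, le_of_lt h2, le_of_lt h3⟩
      rw [← himg] at hp
      obtain ⟨x, hx, rfl⟩ := hp
      simp only [Set.mem_ofPred_eq] at h4 h5
      rw [exp_logChart hx.1] at h4 h5
      have h0 := hx.1 0
      refine ⟨x, ⟨hx, ?_, ?_⟩, rfl⟩
      · rw [mul_div_assoc', div_lt_iff₀ h0] at h4
        exact h4
      · rw [div_lt_iff₀ h0] at h5
        exact h5
    exact fun h0 => (hOo.measure_pos volume hOn).ne' (measure_mono_null hsub h0)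
  -- Indeed `m * (4 - m) = 4 - (ε / A) ^ 2`.
  have hM : (4 : ℝ)⁻¹ < (m * (4 - m))⁻¹ := by
    have hm0 : 0 < m * (4 - m) := mul_pos (by linarith) (by linarith)
    rw [inv_lt_inv₀ (by norm_num) hm0]
    nlinarith [mul_pos hεA0 hεA0]
  calc ENNReal.ofReal ((Real.pi ^ 2 + Real.log (a * b * c) ^ 2) / 8)
      = ENNReal.ofReal (4⁻¹ : ℝ) * volume (logChart e v '' S) := by
        rw [himg, volume_logTriangle_quarter ha hb hc]
    _ ≤ ENNReal.ofReal (4⁻¹ : ℝ) * (volume (logChart e v '' (S ∩ U)) +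
          volume (logChart e v '' (S \ U))) := by
        gcongr
        rw [← Set.inter_union_sdiff S U, Set.image_union, Set.inter_union_sdiff S U]
        exact measure_union_le _ _
    _ = ENNReal.ofReal (4⁻¹ : ℝ) * volume (logChart e v '' (S ∩ U)) +
          ENNReal.ofReal (4⁻¹ : ℝ) * volume (logChart e v '' (S \ U)) := mul_add _ _ _
    _ < ENNReal.ofReal (m * (4 - m))⁻¹ * volume (logChart e v '' (S ∩ U)) +
          ENNReal.ofReal (4⁻¹ : ℝ) * volume (logChart e v '' (S \ U)) := by
        refine ENNReal.add_lt_add_right (ENNReal.mul_ne_top ENNReal.ofReal_ne_top hfin2) ?_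
        refine (ENNReal.mul_lt_mul_iff_left hvol hfin1).2 ?_
        exact (ENNReal.ofReal_lt_ofReal_iff (lt_trans (by norm_num) hM)).2 hM
    _ ≤ (∫⁻ x in S ∩ U, pAreaDensity (hilbertNorm D x)) +
          ∫⁻ x in S \ U, pAreaDensity (hilbertNorm D x) := add_le_add hlow hlow'
    _ = ∫⁻ x in S, pAreaDensity (hilbertNorm D x) := lintegral_inter_add_sdiff _ _ hUm

/-- In a triangle the bound is attained. -/
theorem lintegral_chartTriangle_le {e v : Frame} {D : Set (Fin 2 → ℝ)}
    (hpos : ∀ x, x ∈ D ↔ ∀ i, 0 < chartCoord e v x i) {a b c : ℝ} (ha : 0 < a) (hb : 0 < b)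
    (hc : 0 < c) (h : ∀ z, (∀ i, 0 < v.repr z i) → 0 < e.repr z 2) :
    ∫⁻ x in chartTriangle e v a b c, pAreaDensity (hilbertNorm D x)
      ≤ ENNReal.ofReal ((Real.pi ^ 2 + Real.log (a * b * c) ^ 2) / 8) := by
  rw [← volume_logTriangle_quarter ha hb hc, ← image_logChart_chartTriangle fun z hz => h z hz.1,
    volume_image_logChart (measurableSet_chartTriangle e v a b c) fun x hx => hx.1,
    ← lintegral_const_mul' _ _ ENNReal.ofReal_ne_top]
  refine setLIntegral_mono' (measurableSet_chartTriangle e v a b c) fun x hx => ?_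
  rw [← ENNReal.ofReal_mul (by norm_num), mul_comm, ← div_eq_mul_inv]
  have hx := hx.1
  -- In a triangle the three coordinates alone decide where a ray leaves, so the bounds of
  -- `neg_div_le_gauge` are sharp.
  have hgauge {u : Fin 2 → ℝ} {G : ℝ}
      (hG : ∀ i, -(chartCoordDir e v i u / chartCoord e v x i) ≤ G) :
      gauge {z | x + z ∈ D} u ≤ G := by
    refine le_of_forall_gt_imp_ge_of_dense fun r hr => ?_
    have hz (i : Fin 3) : 0 < v.repr (r • affineVec e x + affineDir e u) i := by
      have h1 := (hG i).trans_lt hr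
      rw [← neg_div, div_lt_iff₀ (hx i), chartCoord, chartCoordDir_apply] at h1
      simp only [map_add, map_smul, Finsupp.add_apply, Finsupp.smul_apply, smul_eq_mul]
      linarith
    -- The vector in `hz` has last chart coordinate `r` and lies in the cone over the triangle,
    -- hence in the patch.
    have hr0 : 0 < r := by simpa using h _ hz
    refine gauge_le_of_mem hr0.le ⟨r⁻¹ • u, ?_, smul_inv_smul₀ hr0.ne' u⟩
    change x + r⁻¹ • u ∈ D
    rw [hpos]
    intro i
    have h2 := mul_pos (inv_pos.2 hr0) (hz i)
    simp only [map_add, map_smul, Finsupp.add_apply, Finsupp.smul_apply, smul_eq_mul, mul_add,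
      inv_mul_cancel_left₀ hr0.ne'] at h2
    rw [chartCoord_add_smul]
    exact h2
  have hnorm {u : Fin 2 → ℝ} {l k : ℝ}
      (hl : ∀ i, l ≤ chartCoordDir e v i u / chartCoord e v x i)
      (hk : ∀ i, chartCoordDir e v i u / chartCoord e v x i ≤ k) (hlk : k - l ≤ 2) :
      hilbertNorm D x u ≤ 1 := by
    have h1 : gauge {z | x + z ∈ D} u ≤ -l := hgauge fun i => neg_le_neg (hl i)
    have h2 : gauge {z | x + z ∈ D} (-u) ≤ k := hgauge fun i => by
      rw [map_neg, neg_div, neg_neg]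
      exact hk i
    rw [hilbertNorm]
    linarith
  have hdet := det_logChartDeriv_ne_zero hx
  have hsurj : Function.Surjective (logChartDeriv e v x) := by
    have h1 : LinearMap.ker (logChartDeriv e v x : (Fin 2 → ℝ) →ₗ[ℝ] (Fin 2 → ℝ)) = ⊥ := by
      rw [← LinearMap.isUnit_iff_ker_eq_bot, LinearMap.isUnit_iff_isUnit_det]
      exact isUnit_iff_ne_zero.2 hdet
    exact LinearMap.injective_iff_surjective.1 (LinearMap.ker_eq_bot.1 h1)
  have hex (p : Fin 2 → ℝ) (hp : ∀ j, 0 ≤ p j ∧ p j ≤ 2) :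
      ∃ u, hilbertNorm D x u ≤ 1 ∧ logChartDeriv e v x u = p := by
    obtain ⟨u, hu⟩ := hsurj p
    have hj (j : Fin 2) : chartCoordDir e v j.succ u / chartCoord e v x j.succ
        = p j + chartCoordDir e v 0 u / chartCoord e v x 0 := by
      rw [← hu, logChartDeriv_apply]
      ring
    refine ⟨u, hnorm (l := chartCoordDir e v 0 u / chartCoord e v x 0)
      (k := chartCoordDir e v 0 u / chartCoord e v x 0 + 2) ?_ ?_ (by linarith), hu⟩
    · intro i
      induction i using Fin.cases with
      | zero => exact le_rfl
      | succ j => linarith [hj j, (hp j).1]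
    · intro i
      induction i using Fin.cases with
      | zero => linarith
      | succ j => linarith [hj j, (hp j).2]
  -- Two vectors of the hexagon which span area 4.
  obtain ⟨u, hu, hu'⟩ := hex ![2, 0] (by simp [Fin.forall_fin_two])
  obtain ⟨u', hu1, hu1'⟩ := hex ![0, 2] (by simp [Fin.forall_fin_two])
  refine pAreaDensity_le hdet (by norm_num) hu hu1 ?_
  rw [hu', hu1']
  norm_num

/-! ### Cones over convex domains -/

-- The saturation of an open set is the union of its multiples by units.
open Projectivization in
theorem isOpenMap_projectivization_mk' :
    IsOpenMap (mk' ℝ : {z : Fin 3 → ℝ // z ≠ 0} → RP2) := by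
  intro U hU
  rw [isOpen_coinduced]
  have : mk' ℝ ⁻¹' (mk' ℝ '' U)
      = ⋃ k : ℝˣ, (fun z : {z : Fin 3 → ℝ // z ≠ 0} =>
          (⟨k • z.1, (smul_ne_zero_iff_ne k).2 z.2⟩ : {z : Fin 3 → ℝ // z ≠ 0})) ⁻¹' U := by
    ext z
    simp only [Set.mem_preimage, Set.mem_image, Set.mem_iUnion]
    constructor
    · rintro ⟨u, hu, huz⟩
      obtain ⟨k, hk⟩ := (mk_eq_mk_iff ℝ u.1 z.1 u.2 z.2).1 huz
      refine ⟨k, ?_⟩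
      convert hu
    · rintro ⟨k, hk⟩
      exact ⟨_, hk, (mk_eq_mk_iff ℝ _ _ _ _).2 ⟨k, rfl⟩⟩
  rw [this]
  refine isOpen_iUnion fun k => hU.preimage ?_
  exact Continuous.subtype_mk (continuous_subtype_val.const_smul k) _

/-- `K` is one of the two open convex cones over the domain `Ω` of the projective plane. -/
structure IsConeOver (K : Set (Fin 3 → ℝ)) (Ω : Set RP2) : Prop where
  isOpen : IsOpen K
  convex : Convex ℝ K
  nonempty : K.Nonempty
  smul_mem : ∀ {r : ℝ} {z : Fin 3 → ℝ}, 0 < r → z ∈ K → r • z ∈ K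
  mk_mem_iff : ∀ (z : Fin 3 → ℝ) (hz : z ≠ 0),
    Projectivization.mk ℝ z hz ∈ Ω ↔ z ∈ K ∨ -z ∈ K
  zero_notMem : 0 ∉ K

theorem repr_two_ne_zero_of_mem_range {e : Frame} {z : Fin 3 → ℝ} {hz : z ≠ 0}
    (h : Projectivization.mk ℝ z hz ∈ Set.range (affineChart e)) : e.repr z 2 ≠ 0 := by
  obtain ⟨x, hx⟩ := h
  obtain ⟨r, hr⟩ := (Projectivization.mk_eq_mk_iff' ℝ _ _ _ _).1 hx
  intro h0
  have h2 : r * e.repr z 2 = 1 := by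
    rw [← smul_eq_mul, ← Finsupp.smul_apply, ← map_smul, hr]
    exact repr_affineVec_two e x
  simp [h0] at h2

theorem mk_smul_eq {z : Fin 3 → ℝ} (hz : z ≠ 0) {r : ℝ} (hr : r • z ≠ 0) :
    Projectivization.mk ℝ (r • z) hr = Projectivization.mk ℝ z hz :=
  (Projectivization.mk_eq_mk_iff' ℝ _ _ _ _).2 ⟨r, rfl⟩

theorem mk_neg_eq {z : Fin 3 → ℝ} (hz : z ≠ 0) (hz' : -z ≠ 0) :
    Projectivization.mk ℝ (-z) hz' = Projectivization.mk ℝ z hz :=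
  (Projectivization.mk_eq_mk_iff' ℝ _ _ _ _).2 ⟨-1, by simp⟩

theorem IsProperlyConvex.exists_isConeOver {Ω : Set RP2} (hΩ : IsProperlyConvex Ω) :
    ∃ K, IsConeOver K Ω := by
  obtain ⟨ho, ⟨P, hP⟩, e, hcl, hconv⟩ := hΩ
  have hsub : Ω ⊆ Set.range (affineChart e) := subset_closure.trans hcl
  set K : Set (Fin 3 → ℝ) := {z | 0 < e.repr z 2} ∩
    Subtype.val '' ((Projectivization.mk' ℝ : {z : Fin 3 → ℝ // z ≠ 0} → RP2) ⁻¹' Ω) with hK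
  have hmem {z : Fin 3 → ℝ} : z ∈ K ↔
      0 < e.repr z 2 ∧ ∃ hz : z ≠ 0, Projectivization.mk ℝ z hz ∈ Ω := by
    constructor
    · rintro ⟨h1, ⟨y, hy⟩, h2, rfl⟩
      exact ⟨h1, hy, h2⟩
    · rintro ⟨h1, hz, h2⟩
      exact ⟨h1, ⟨z, hz⟩, h2, rfl⟩
  have hiff (z : Fin 3 → ℝ) (hz : z ≠ 0) :
      Projectivization.mk ℝ z hz ∈ Ω ↔ z ∈ K ∨ -z ∈ K := by
    constructor
    · intro h
      rcases lt_or_gt_of_ne (repr_two_ne_zero_of_mem_range (hsub h)) with h2 | h2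
      · refine Or.inr (hmem.2 ⟨by simpa using h2, neg_ne_zero.2 hz, ?_⟩)
        rwa [mk_neg_eq hz]
      · exact Or.inl (hmem.2 ⟨h2, hz, h⟩)
    · rintro (h | h)
      · exact (hmem.1 h).2.2
      · obtain ⟨-, hz', h'⟩ := hmem.1 h
        rwa [mk_neg_eq hz] at h'
  have hsmul {r : ℝ} {z : Fin 3 → ℝ} (hr : 0 < r) (hz : z ∈ K) : r • z ∈ K := by
    obtain ⟨h1, h2, h3⟩ := hmem.1 hz
    refine hmem.2 ⟨by simpa using mul_pos hr h1, smul_ne_zero hr.ne' h2, ?_⟩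
    rwa [mk_smul_eq h2]
  have haff (x : Fin 2 → ℝ) : affineVec e x ∈ K ↔ x ∈ affineChart e ⁻¹' Ω := by
    rw [hmem]
    constructor
    · rintro ⟨-, _, h⟩
      exact h
    · intro h
      exact ⟨by simp, affineVec_ne_zero e x, h⟩
  refine ⟨K, ?_, ?_, ?_, hsmul, hiff, ?_⟩
  · refine IsOpen.inter (isOpen_lt continuous_const ?_) ?_
    · exact (LinearMap.continuous_of_finiteDimensional (e.coord 2))
    · exact isOpen_ne.isOpenMap_subtype_val _ (ho.preimage continuous_coinduced_rng)
  · intro z hz z' hz' α β hα hβ hαβ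
    have h1 := (hmem.1 hz).1
    have h1' := (hmem.1 hz').1
    obtain ⟨x, hx⟩ := exists_affineVec_eq e h1.ne'
    obtain ⟨x', hx'⟩ := exists_affineVec_eq e h1'.ne'
    have hxD : x ∈ affineChart e ⁻¹' Ω := (haff x).1 (hx ▸ hsmul (inv_pos.2 h1) hz)
    have hxD' : x' ∈ affineChart e ⁻¹' Ω := (haff x').1 (hx' ▸ hsmul (inv_pos.2 h1') hz')
    rw [eq_inv_smul_iff₀ h1.ne'] at hx
    rw [eq_inv_smul_iff₀ h1'.ne'] at hx'
    set s := e.repr z 2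
    set s' := e.repr z' 2
    have hH : 0 < α * s + β * s' := by
      rcases hα.eq_or_lt with rfl | hα
      · have : β = 1 := by linarith
        simpa [this] using h1'
      · exact add_pos_of_pos_of_nonneg (mul_pos hα h1) (mul_nonneg hβ h1'.le)
    -- `H` is the last chart coordinate of the combination; after division by it the weights in the
    -- chart are `α s / H` and `β s' / H`.
    set H := α * s + β * s' with hHdef
    have hsum : α * s / H + β * s' / H = 1 := by
      rw [← add_div, div_self hH.ne']
    have hcomb := hconv hxD hxD' (by positivity : 0 ≤ α * s / H)
      (by positivity : 0 ≤ β * s' / H) hsum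
    have hin := hsmul hH ((haff _).2 hcomb)
    convert hin using 1
    rw [← hx, ← hx', affineVec_eq, affineVec_eq, affineVec_eq, map_add, map_smul, map_smul]
    simp only [smul_add, smul_smul]
    rw [mul_div_cancel₀ _ hH.ne', mul_div_cancel₀ _ hH.ne', hHdef, add_smul]
    abel
  · obtain ⟨x, rfl⟩ := hsub hP
    exact ⟨_, (haff x).2 hP⟩
  · intro h0
    exact (hmem.1 h0).2.1 rfl

namespace IsConeOver

variable {K : Set (Fin 3 → ℝ)} {Ω : Set RP2}

open Pointwise in
theorem neg (hK : IsConeOver K Ω) : IsConeOver (-K) Ω where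
  isOpen := hK.isOpen.neg
  convex := hK.convex.neg
  nonempty := hK.nonempty.neg
  smul_mem := fun hr hz => by
    rw [Set.mem_neg, ← smul_neg]
    exact hK.smul_mem hr hz
  mk_mem_iff := fun z hz => by
    rw [hK.mk_mem_iff z hz, Set.mem_neg, Set.mem_neg, neg_neg, or_comm]
  zero_notMem := by simpa using hK.zero_notMem

theorem ne_zero (hK : IsConeOver K Ω) {z : Fin 3 → ℝ} (hz : z ∈ K) : z ≠ 0 :=
  fun h => hK.zero_notMem (h ▸ hz)

theorem mk_mem (hK : IsConeOver K Ω) {z : Fin 3 → ℝ} (hz : z ∈ K) :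
    Projectivization.mk ℝ z (hK.ne_zero hz) ∈ Ω :=
  (hK.mk_mem_iff z _).2 (Or.inl hz)

theorem add_mem (hK : IsConeOver K Ω) {z z' : Fin 3 → ℝ} (hz : z ∈ K) (hz' : z' ∈ K) :
    z + z' ∈ K := by
  have h := hK.smul_mem two_pos (hK.convex hz hz' (a := 1 / 2) (b := 1 / 2) (by norm_num)
    (by norm_num) (by norm_num))
  simpa [smul_smul] using h

theorem add_mem_closure (hK : IsConeOver K Ω) {z z' : Fin 3 → ℝ} (hz : z ∈ closure K)
    (hz' : z' ∈ closure K) : z + z' ∈ closure K :=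
  map_mem_closure₂ continuous_add hz hz' fun _ h _ h' => hK.add_mem h h'

theorem smul_mem_closure (hK : IsConeOver K Ω) {r : ℝ} (hr : 0 ≤ r) {z : Fin 3 → ℝ}
    (hz : z ∈ closure K) : r • z ∈ closure K := by
  have hr' : r ∈ closure (Set.Ioi (0 : ℝ)) := by rwa [closure_Ioi]
  exact map_mem_closure₂ continuous_smul hr' hz fun _ h _ h' => hK.smul_mem h h'

theorem sum_mem_closure (hK : IsConeOver K Ω) {W : Fin 3 → Fin 3 → ℝ}
    (hW : ∀ i, W i ∈ closure K) {d : Fin 3 → ℝ} (hd : ∀ i, 0 ≤ d i) :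
    ∑ i, d i • W i ∈ closure K := by
  rw [Fin.sum_univ_three]
  exact hK.add_mem_closure (hK.add_mem_closure (hK.smul_mem_closure (hd 0) (hW 0))
    (hK.smul_mem_closure (hd 1) (hW 1))) (hK.smul_mem_closure (hd 2) (hW 2))

/-- A convex cone with points on both sides of the kernel of `f` would meet that kernel. -/
theorem pos_or_neg (hK : IsConeOver K Ω) {f : (Fin 3 → ℝ) →ₗ[ℝ] ℝ} (hf : ∀ z ∈ K, f z ≠ 0) :
    (∀ z ∈ K, 0 < f z) ∨ ∀ z ∈ K, f z < 0 := by
  by_contra! h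
  obtain ⟨⟨z, hz, hfz⟩, z', hz', hfz'⟩ := h
  have h1 : 0 < -f z := neg_pos.2 (lt_of_le_of_ne hfz (hf z hz))
  have h2 : 0 < f z' := lt_of_le_of_ne hfz' (hf z' hz').symm
  refine hf _ (hK.add_mem (hK.smul_mem h2 hz) (hK.smul_mem h1 hz')) ?_
  simp only [map_add, map_smul, smul_eq_mul]
  ring

-- The projection is open and continuous, so closures commute with preimages, and the preimage of Ω
-- is `K ∪ -K`.
open Pointwise in
theorem mk_mem_closure_iff (hK : IsConeOver K Ω) (z : Fin 3 → ℝ) (hz : z ≠ 0) :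
    Projectivization.mk ℝ z hz ∈ closure Ω ↔ z ∈ closure K ∨ -z ∈ closure K := by
  have h1 : Subtype.val '' ((Projectivization.mk' ℝ : {z : Fin 3 → ℝ // z ≠ 0} → RP2) ⁻¹' Ω)
      = K ∪ -K := by
    ext y
    constructor
    · rintro ⟨⟨y, hy⟩, h, rfl⟩
      exact (hK.mk_mem_iff y hy).1 h
    · intro h
      have hy : y ≠ 0 := by
        rintro rfl
        rcases h with h | h
        · exact hK.zero_notMem h
        · exact hK.zero_notMem (by simpa using h)
      exact ⟨⟨y, hy⟩, (hK.mk_mem_iff y hy).2 h, rfl⟩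
  change (⟨z, hz⟩ : {z : Fin 3 → ℝ // z ≠ 0}) ∈ Projectivization.mk' ℝ ⁻¹' closure Ω ↔ _
  rw [isOpenMap_projectivization_mk'.preimage_closure_eq_closure_preimage
    continuous_coinduced_rng, closure_subtype, h1, closure_union, ← neg_closure]
  rfl

theorem isOpen_domain (hK : IsConeOver K Ω) : IsOpen Ω := by
  have h : Ω = Projectivization.mk' ℝ '' (Subtype.val ⁻¹' K :
      Set {z : Fin 3 → ℝ // z ≠ 0}) := by
    ext P
    induction P using Projectivization.ind with
    | h z hz =>
      constructor
      · intro h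
        rcases (hK.mk_mem_iff z hz).1 h with h | h
        · exact ⟨⟨z, hz⟩, h, rfl⟩
        · exact ⟨⟨-z, neg_ne_zero.2 hz⟩, h, mk_neg_eq hz _⟩
      · rintro ⟨⟨y, hy⟩, h, h'⟩
        rw [← h']
        exact hK.mk_mem h
  rw [h]
  exact isOpenMap_projectivization_mk' _ (hK.isOpen.preimage continuous_subtype_val)

theorem mk_mem_frontier_iff (hK : IsConeOver K Ω) (z : Fin 3 → ℝ) (hz : z ≠ 0) :
    Projectivization.mk ℝ z hz ∈ frontier Ω ↔
      (z ∈ closure K ∨ -z ∈ closure K) ∧ z ∉ K ∧ -z ∉ K := by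
  rw [hK.isOpen_domain.frontier_eq, Set.mem_sdiff, hK.mk_mem_closure_iff, hK.mk_mem_iff, not_or]

end IsConeOver

/-! ### Normalization of signs -/

/-- The basis `-v`. -/
noncomputable def negFrame (v : Frame) : Frame := v.map (LinearEquiv.neg ℝ)

@[simp]
theorem negFrame_apply (v : Frame) (i : Fin 3) : negFrame v i = -v i := by
  simp [negFrame]

@[simp]
theorem repr_negFrame (v : Frame) (z : Fin 3 → ℝ) (i : Fin 3) :
    (negFrame v).repr z i = -v.repr z i := by
  simp [negFrame]

theorem mk_mem_openTriangle_iff {v : Frame} {z : Fin 3 → ℝ} (hz : z ≠ 0) :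
    Projectivization.mk ℝ z hz ∈ openTriangle v ↔
      (∀ i, 0 < v.repr z i) ∨ ∀ i, v.repr z i < 0 := by
  constructor
  · rintro ⟨x, hx, h, hP⟩
    obtain ⟨r, hr⟩ := (Projectivization.mk_eq_mk_iff' ℝ _ _ _ _).1 hP
    have hrep (i : Fin 3) : v.repr z i = r * x i := by
      rw [← hr, map_smul, Finsupp.smul_apply, v.repr_sum_self, smul_eq_mul]
    have hr0 : r ≠ 0 := by
      rintro rfl
      exact hz (by rw [← hr, zero_smul])
    simp only [hrep]
    rcases lt_or_gt_of_ne hr0 with h0 | h0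
    · exact Or.inr fun i => mul_neg_of_neg_of_pos h0 (hx i)
    · exact Or.inl fun i => mul_pos h0 (hx i)
  · rintro (h | h)
    · refine ⟨v.repr z, h, ?_⟩
      simp only [v.sum_repr]
      exact ⟨hz, trivial⟩
    · refine ⟨fun i => -v.repr z i, fun i => neg_pos.2 (h i), ?_⟩
      simp only [neg_smul, Finset.sum_neg_distrib, v.sum_repr]
      exact ⟨neg_ne_zero.2 hz, (mk_neg_eq hz _).symm⟩

theorem openTriangle_negFrame (v : Frame) : openTriangle (negFrame v) = openTriangle v := by
  ext P
  induction P using Projectivization.ind with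
  | h z hz =>
    rw [mk_mem_openTriangle_iff, mk_mem_openTriangle_iff, or_comm]
    simp

/-- The patch of `e` is only required to contain Ω, not its closure, and may differ from the one
which witnesses proper convexity; the sign of the cone is therefore chosen anew. -/
theorem IsConeOver.exists_chart_pos {Ω : Set RP2} {K : Set (Fin 3 → ℝ)} (hK : IsConeOver K Ω)
    {e : Frame} (he : Ω ⊆ Set.range (affineChart e)) :
    ∃ K', IsConeOver K' Ω ∧ ∀ z ∈ K', 0 < e.repr z 2 := by
  rcases hK.pos_or_neg (f := e.coord 2) fun z hz =>
    repr_two_ne_zero_of_mem_range (he (hK.mk_mem hz)) with h | h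
  · exact ⟨K, hK, h⟩
  · refine ⟨_, hK.neg, fun z hz => ?_⟩
    simpa using h _ hz

theorem IsConeOver.repr_pos_or_neg {Ω : Set RP2} {K : Set (Fin 3 → ℝ)} (hK : IsConeOver K Ω)
    {v : Frame} (hv : Ω ⊆ openTriangle v) :
    (∀ z ∈ K, ∀ i, 0 < v.repr z i) ∨ ∀ z ∈ K, ∀ i, 0 < (negFrame v).repr z i := by
  have hm (z) (hz : z ∈ K) := (mk_mem_openTriangle_iff (hK.ne_zero hz)).1 (hv (hK.mk_mem hz))
  have hne : ∀ z ∈ K, v.coord 0 z ≠ 0 := by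
    intro z hz
    rcases hm z hz with h | h
    · exact (h 0).ne'
    · exact (h 0).ne
  rcases hK.pos_or_neg hne with h | h
  · refine Or.inl fun z hz => (hm z hz).resolve_right fun h' => ?_
    exact lt_asymm (h z hz) (h' 0)
  · refine Or.inr fun z hz i => ?_
    have := (hm z hz).resolve_left fun h' => lt_asymm (h z hz) (h' 0)
    simpa using this i

theorem IsShapeInTriangle.negFrame {v w : Frame} {t : ℝ} (h : IsShapeInTriangle v w t) :
    IsShapeInTriangle (negFrame v) w t := by
  have hneg {x y y' : Fin 3 → ℝ} (hs : SamePoint x y) (hy : y' = -y) : SamePoint x y' := by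
    obtain ⟨k, hk, rfl⟩ := hs
    exact ⟨-k, neg_ne_zero.2 hk, by simp [hy]⟩
  obtain ⟨a, b, c, ha, hb, hc, h0, h1, h2, ht⟩ := h
  refine ⟨a, b, c, ha, hb, hc, hneg h0 ?_, hneg h1 ?_, hneg h2 ?_, ht⟩ <;>
    simp only [negFrame_apply, smul_neg, neg_add]

/-! ### Ideal triangles -/

/-- The vertices of the ideal triangle with parameters `a, b, c` in the triangle `v`. -/
noncomputable def idealVertex (v : Frame) (a b c : ℝ) : Fin 3 → Fin 3 → ℝ :=
  ![v 0 + a • v 1, v 1 + b • v 2, v 2 + c • v 0]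

theorem repr_sum_idealVertex (v : Frame) (a b c : ℝ) (d : Fin 3 → ℝ) :
    ⇑(v.repr (∑ i, d i • idealVertex v a b c i))
      = ![d 0 + c * d 2, a * d 0 + d 1, b * d 1 + d 2] := by
  ext i
  fin_cases i <;> simp [idealVertex, Fin.sum_univ_three] <;> ring

theorem repr_idealVertex_zero (v : Frame) (a b c : ℝ) :
    ⇑(v.repr (idealVertex v a b c 0)) = ![1, a, 0] := by
  ext i
  fin_cases i <;> simp [idealVertex]

theorem repr_idealVertex_one (v : Frame) (a b c : ℝ) :
    ⇑(v.repr (idealVertex v a b c 1)) = ![0, 1, b] := by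
  ext i
  fin_cases i <;> simp [idealVertex]

theorem repr_idealVertex_two (v : Frame) (a b c : ℝ) :
    ⇑(v.repr (idealVertex v a b c 2)) = ![c, 0, 1] := by
  ext i
  fin_cases i <;> simp [idealVertex]

theorem repr_idealVertex_add_two (v : Frame) (a b c : ℝ) (j : Fin 3) :
    v.repr (idealVertex v a b c j) (j + 2) = 0 := by
  fin_cases j
  · simp [repr_idealVertex_zero]
  · simp [repr_idealVertex_one]
  · simp [repr_idealVertex_two]

theorem repr_idealVertex_add_two_pos (v : Frame) {a b c : ℝ} (ha : 0 < a) (hb : 0 < b)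
    (hc : 0 < c) {j l : Fin 3} (hjl : j ≠ l) : 0 < v.repr (idealVertex v a b c l) (j + 2) := by
  fin_cases j <;> fin_cases l <;>
    simp_all [repr_idealVertex_zero, repr_idealVertex_one, repr_idealVertex_two]

/-- The weights are found by inverting the matrix of the vertices, whose determinant is `1 + a * b *
c`. Two of them are non-zero because each vertex lies on a side of the triangle `v`, where a
coordinate vanishes. -/
theorem exists_sum_idealVertex_eq (v : Frame) {a b c : ℝ} (ha : 0 < a) (hb : 0 < b) (hc : 0 < c)
    {z : Fin 3 → ℝ} (hz : ⇑(v.repr z) ∈ triangleCone a b c) :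
    ∃ d : Fin 3 → ℝ, (∀ i, 0 ≤ d i) ∧ (∃ i j, i ≠ j ∧ d i ≠ 0 ∧ d j ≠ 0) ∧
      ∑ i, d i • idealVertex v a b c i = z := by
  obtain ⟨hpos, h0, h1, h2⟩ := hz
  set y := v.repr z with hy
  have ht : 0 < 1 + a * b * c := by positivity
  set d : Fin 3 → ℝ := ![(y 0 + b * c * y 1 - c * y 2) / (1 + a * b * c),
    (y 1 + c * a * y 2 - a * y 0) / (1 + a * b * c),
    (y 2 + a * b * y 0 - b * y 1) / (1 + a * b * c)] with hd
  have hd0 (i : Fin 3) : 0 ≤ d i := by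
    fin_cases i
    · exact div_nonneg (by linarith) ht.le
    · exact div_nonneg (by linarith) ht.le
    · exact div_nonneg (by linarith) ht.le
  have hrep : ![d 0 + c * d 2, a * d 0 + d 1, b * d 1 + d 2] = y := by
    ext i
    fin_cases i
    all_goals
      simp [hd]
      field_simp
      ring
  have hsum : ∑ i, d i • idealVertex v a b c i = z := by
    refine v.repr.injective (DFunLike.coe_injective ?_)
    rw [repr_sum_idealVertex, hrep]
  refine ⟨d, hd0, ?_, hsum⟩
  have e0 : d 0 + c * d 2 = y 0 := congrFun hrep 0
  have e1 : a * d 0 + d 1 = y 1 := congrFun hrep 1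
  have e2 : b * d 1 + d 2 = y 2 := congrFun hrep 2
  by_cases g0 : d 0 = 0
  · refine ⟨1, 2, by decide, fun g => ?_, fun g => ?_⟩
    · have := hpos 1
      rw [← e1, g0, g] at this
      simp at this
    · have := hpos 0
      rw [← e0, g0, g] at this
      simp at this
  · by_cases g1 : d 1 = 0
    · refine ⟨0, 2, by decide, g0, fun g => ?_⟩
      have := hpos 2
      rw [← e2, g1, g] at this
      simp at this
    · exact ⟨0, 1, by decide, g0, g1⟩

theorem repr_sum_idealVertex_mem {v : Frame} {a b c : ℝ} (ha : 0 < a) (hb : 0 < b) (hc : 0 < c)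
    {d : Fin 3 → ℝ} (hd : ∀ i, 0 ≤ d i)
    (hpos : ∀ i, 0 < v.repr (∑ i, d i • idealVertex v a b c i) i) :
    ⇑(v.repr (∑ i, d i • idealVertex v a b c i)) ∈ triangleCone a b c := by
  have h0 := hd 0
  have h1 := hd 1
  have h2 := hd 2
  have ht : 0 < a * b * c := by positivity
  refine ⟨hpos, ?_⟩
  rw [repr_sum_idealVertex]
  simp only [Matrix.cons_val]
  refine ⟨?_, ?_, ?_⟩
  · linarith [mul_nonneg ht.le h0]
  · linarith [mul_nonneg ht.le h1]
  · linarith [mul_nonneg ht.le h2]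

theorem repr_nonneg_of_mem_closure {K : Set (Fin 3 → ℝ)}
    {v : Frame} (hv : ∀ z ∈ K, ∀ i, 0 < v.repr z i) {z : Fin 3 → ℝ} (hz : z ∈ closure K)
    (i : Fin 3) : 0 ≤ v.repr z i := by
  have hc : Continuous fun z => v.repr z i := LinearMap.continuous_of_finiteDimensional (v.coord i)
  have := map_mem_closure hc hz (t := Set.Ioi 0) fun z hz => hv z hz i
  rwa [closure_Ioi] at this

/-- A combination of the vertices of an ideal triangle which represents a point of the triangle
other than a vertex lies in the cone as soon as it lies in its closure. -/
theorem IsConeOver.mem_of_mem_closure_of_idealTriangle {Ω : Set RP2} {K : Set (Fin 3 → ℝ)}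
    (hK : IsConeOver K Ω) {v w : Frame} (hv : ∀ z ∈ K, ∀ i, 0 < v.repr z i)
    (hw : IsIdealTriangle Ω w) {W : Fin 3 → Fin 3 → ℝ} {k : Fin 3 → ℝ} (hk : ∀ i, k i ≠ 0)
    (hkw : ∀ i, w i = k i • W i) {d : Fin 3 → ℝ} {τ : ℝ} (hτ : τ ≠ 0)
    (hd : ∀ i, 0 ≤ τ * d i * k i) {i j : Fin 3} (hij : i ≠ j) (hdi : d i ≠ 0) (hdj : d j ≠ 0)
    (hz : ∑ i, d i • W i ∈ closure K) : ∑ i, d i • W i ∈ K := by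
  -- The weights of `τ • ∑ i, d i • W i` in the basis `w`. They are non-negative, so the point
  -- belongs to the closed triangle of `w`; as two of them are non-zero, it is not a vertex and
  -- hence not on the frontier.
  set s : Fin 3 → ℝ := fun i => τ * d i / k i with hs
  have hs0 (i : Fin 3) : 0 ≤ s i := by
    have : s i = τ * d i * k i / (k i * k i) := by
      have := hk i
      simp only [hs]
      field_simp
    rw [this]
    exact div_nonneg (hd i) (mul_self_nonneg _)
  have hsw : ∑ i, s i • w i = τ • ∑ i, d i • W i := by
    rw [Finset.smul_sum]
    refine Finset.sum_congr rfl fun i _ => ?_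
    rw [hkw, smul_smul, smul_smul, hs]
    simp only [div_mul_cancel₀ _ (hk i)]
  have hne : ∑ i, s i • w i ≠ 0 := by
    intro h0
    have := congrArg (fun z => w.repr z i) h0
    simp only [w.repr_sum_self, map_zero, Finsupp.zero_apply, hs] at this
    exact div_ne_zero (mul_ne_zero hτ hdi) (hk i) this
  have hnz : ∑ i, d i • W i ≠ 0 := by
    intro h0
    rw [hsw, h0, smul_zero] at hne
    exact hne rfl
  set z := ∑ i, d i • W i with hzdef
  have hmk : Projectivization.mk ℝ z hnz = Projectivization.mk ℝ (∑ i, s i • w i) hne :=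
    (Projectivization.mk_eq_mk_iff' ℝ _ _ _ _).2 ⟨τ⁻¹, by rw [hsw, inv_smul_smul₀ hτ]⟩
  have hnf : Projectivization.mk ℝ z hnz ∉ frontier Ω := by
    intro hf
    have hv : Projectivization.mk ℝ z hnz ∈ triangleVertices w := by
      rw [← hw]
      exact ⟨⟨s, hs0, hne, hmk⟩, hf⟩
    obtain ⟨l, hl⟩ := hv
    rw [hmk] at hl
    obtain ⟨r, hr⟩ := (Projectivization.mk_eq_mk_iff' ℝ _ _ _ _).1 hl
    have hzero (i : Fin 3) (hi : i ≠ l) : d i = 0 := by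
      have h1 := congrArg (fun z => w.repr z i) hr
      simp only [map_smul, Finsupp.smul_apply, w.repr_sum_self, w.repr_self, smul_eq_mul,
        Finsupp.single_apply, if_neg hi.symm, hs] at h1
      have hr0 : r ≠ 0 := by
        rintro rfl
        rw [zero_smul] at hr
        exact w.ne_zero l hr.symm
      have h2 := (mul_eq_zero.1 h1).resolve_left hr0
      rw [div_eq_zero_iff] at h2
      exact (mul_eq_zero.1 (h2.resolve_right (hk i))).resolve_left hτ
    rcases eq_or_ne i l with rfl | hi
    · exact hdj (hzero j hij.symm)
    · exact hdi (hzero i hi)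
  rw [hK.mk_mem_frontier_iff] at hnf
  by_contra hzK
  refine hnf ⟨Or.inl hz, hzK, fun hneg => ?_⟩
  have h1 := repr_nonneg_of_mem_closure hv hz 0
  have h2 := hv _ hneg 0
  simp only [map_neg, Finsupp.neg_apply] at h2
  linarith

theorem exists_sign_change {k : Fin 3 → ℝ} (hk : ∀ i, k i ≠ 0)
    (h : ¬∃ τ : ℝ, ∀ i, 0 < τ * k i) :
    ∃ i j l : Fin 3, i ≠ j ∧ i ≠ l ∧ j ≠ l ∧ 0 < k i * k j ∧ k i * k l < 0 := by
  push Not at h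
  have hpm (i : Fin 3) := lt_or_gt_of_ne (hk i)
  have h1 := h 1
  have h2 := h (-1)
  simp only [Fin.exists_fin_succ, one_mul, neg_mul] at h1 h2
  rcases hpm 0 with h0' | h0' <;> rcases hpm 1 with h1' | h1' <;> rcases hpm 2 with h2' | h2'
  · exfalso
    rcases h2 with h | h | h | ⟨i, -⟩
    · linarith
    · change -k 1 ≤ 0 at h
      linarith
    · change -k 2 ≤ 0 at h
      linarith
    · exact i.elim0
  · exact ⟨0, 1, 2, by decide, by decide, by decide, mul_pos_of_neg_of_neg h0' h1',
      mul_neg_of_neg_of_pos h0' h2'⟩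
  · exact ⟨0, 2, 1, by decide, by decide, by decide, mul_pos_of_neg_of_neg h0' h2',
      mul_neg_of_neg_of_pos h0' h1'⟩
  · exact ⟨1, 2, 0, by decide, by decide, by decide, mul_pos h1' h2',
      mul_neg_of_pos_of_neg h1' h0'⟩
  · exact ⟨1, 2, 0, by decide, by decide, by decide, mul_pos_of_neg_of_neg h1' h2',
      mul_neg_of_neg_of_pos h1' h0'⟩
  · exact ⟨0, 2, 1, by decide, by decide, by decide, mul_pos h0' h2',
      mul_neg_of_pos_of_neg h0' h1'⟩
  · exact ⟨0, 1, 2, by decide, by decide, by decide, mul_pos h0' h1',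
      mul_neg_of_pos_of_neg h0' h2'⟩
  · exfalso
    rcases h1 with h | h | h | ⟨i, -⟩
    · linarith
    · change k 1 ≤ 0 at h
      linarith
    · change k 2 ≤ 0 at h
      linarith
    · exact i.elim0

theorem IsConeOver.idealVertex_mem {Ω : Set RP2} {K : Set (Fin 3 → ℝ)}
    (hK : IsConeOver K Ω) {v w : Frame} (hv : ∀ z ∈ K, ∀ i, 0 < v.repr z i)
    (hw : IsIdealTriangle Ω w) {a b c : ℝ} (ha : 0 < a) (hb : 0 < b) (hc : 0 < c)
    {k : Fin 3 → ℝ} (hkw : ∀ i, w i = k i • idealVertex v a b c i) (i : Fin 3) :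
    idealVertex v a b c i ∈ closure K ∧ idealVertex v a b c i ∉ K := by
  set W := idealVertex v a b c with hW
  have hne : W i ≠ 0 := by
    intro h0
    refine w.ne_zero i ?_
    rw [hkw, h0, smul_zero]
  have hf : Projectivization.mk ℝ (W i) hne ∈ frontier Ω := by
    have h1 : Projectivization.mk ℝ (w i) (w.ne_zero i) ∈ triangleVertices w := ⟨i, rfl⟩
    rw [← hw] at h1
    have h2 := h1.2
    simp only [hkw i] at h2
    rwa [mk_smul_eq hne] at h2
  obtain ⟨h1, h2, -⟩ := (hK.mk_mem_frontier_iff _ _).1 hf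
  refine ⟨h1.resolve_right fun h3 => ?_, h2⟩
  -- In `Fin 3` the index `i + 1 + 2` is `i`, a coordinate in which the vertex `i` is positive.
  have h4 := repr_nonneg_of_mem_closure hv h3 (i + 1 + 2)
  have h5 := repr_idealVertex_add_two_pos v ha hb hc (j := i + 1) (l := i) (by simp)
  simp only [map_neg, Finsupp.neg_apply] at h4
  rw [← hW] at h5
  linarith

/-- The vertices of an ideal triangle can be normalized by a common sign. -/
theorem IsConeOver.exists_common_sign {Ω : Set RP2} {K : Set (Fin 3 → ℝ)}
    (hK : IsConeOver K Ω) {v w : Frame} (hv : ∀ z ∈ K, ∀ i, 0 < v.repr z i)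
    (hw : IsIdealTriangle Ω w) {a b c : ℝ} (ha : 0 < a) (hb : 0 < b) (hc : 0 < c)
    {k : Fin 3 → ℝ} (hk : ∀ i, k i ≠ 0) (hkw : ∀ i, w i = k i • idealVertex v a b c i) :
    ∃ τ : ℝ, ∀ i, 0 < τ * k i := by
  by_contra hcon
  obtain ⟨i, j, l, hij, hil, hjl, hkij, hkil⟩ := exists_sign_change hk hcon
  have hcl := fun i => (hK.idealVertex_mem hv hw ha hb hc hkw i).1
  set W := idealVertex v a b c with hW
  -- With mixed signs the path from `W i + W j` to `W i - W l` stays, up to sign, in the closed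
  -- triangle of `w` and avoids its vertices. Its points in the closure of `K` therefore lie in `K`.
  -- By connectedness the path, which starts in `K`, also ends there; but the coordinate `i + 2` of
  -- `W i - W l` is negative.
  set d : ℝ → Fin 3 → ℝ := fun s => Pi.single i 1 + (1 - s) • Pi.single j 1 - s • Pi.single l 1
    with hd
  have hdi (s : ℝ) : d s i = 1 := by simp [hd, hij, hil]
  have hdj (s : ℝ) : d s j = 1 - s := by simp [hd, hij.symm, hjl]
  have hdl (s : ℝ) : d s l = -s := by simp [hd, hil.symm, hjl.symm]
  have hall (n : Fin 3) : n = i ∨ n = j ∨ n = l := by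
    have : ∀ i j l n : Fin 3, i ≠ j → i ≠ l → j ≠ l → n = i ∨ n = j ∨ n = l := by decide
    exact this i j l n hij hil hjl
  have hsum (s : ℝ) : ∑ n, d s n • W n = W i + (1 - s) • W j - s • W l := by
    simp only [hd, Pi.add_apply, Pi.sub_apply, Pi.smul_apply, add_smul, sub_smul,
      Finset.sum_add_distrib, Finset.sum_sub_distrib, smul_assoc]
    simp [Pi.single_apply, ite_smul]
  have hstep {s : ℝ} (hs : s ∈ Set.Icc (0 : ℝ) 1) (hz : W i + (1 - s) • W j - s • W l ∈ closure K) :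
      W i + (1 - s) • W j - s • W l ∈ K := by
    rw [← hsum] at hz ⊢
    have hsign (n : Fin 3) : 0 ≤ k i * d s n * k n := by
      rcases hall n with rfl | rfl | rfl
      · rw [hdi]
        linarith [mul_self_nonneg (k n)]
      · rw [hdj]
        nlinarith [hs.2]
      · rw [hdl]
        nlinarith [hs.1]
    rcases eq_or_ne s 1 with rfl | hs1
    · exact hK.mem_of_mem_closure_of_idealTriangle hv hw hk hkw (hk i) hsign hil
        (by simp [hdi]) (by simp [hdl]) hz
    · exact hK.mem_of_mem_closure_of_idealTriangle hv hw hk hkw (hk i) hsign hij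
        (by simp [hdi]) (by rw [hdj]; exact sub_ne_zero.2 hs1.symm) hz
  have hcont : Continuous fun s : ℝ => W i + (1 - s) • W j - s • W l := by fun_prop
  have hstart : W i + (1 - (0 : ℝ)) • W j - (0 : ℝ) • W l ∈ K := by
    refine hstep (by simp) ?_
    simpa using hK.add_mem_closure (hcl i) (hcl j)
  have hconn := (isPreconnected_Icc (a := (0 : ℝ)) (b := 1)).subset_of_closure_inter_subset
    (hK.isOpen.preimage hcont) ⟨0, by simp, hstart⟩
    (fun s hs => hstep hs.2
      (map_mem_closure (f := fun s : ℝ => W i + (1 - s) • W j - s • W l) hcont hs.1 fun _ h => h))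
  have hend : W i + (1 - (1 : ℝ)) • W j - (1 : ℝ) • W l ∈ K :=
    hconn (by simp : (1 : ℝ) ∈ Set.Icc (0 : ℝ) 1)
  have h1 := hv _ hend (i + 2)
  have h2 := repr_idealVertex_add_two v a b c i
  have h3 := repr_idealVertex_add_two_pos v ha hb hc hil
  rw [← hW] at h2 h3
  simp [h2] at h1
  linarith

/-! ### Area bounds in terms of the cone -/

/-- The cone `K` over a domain lies in the patch of the chart `e` and in the triangle `v`, and it
contains the ideal triangle with parameters `a, b, c`. -/
structure IsTriangleConfig (K : Set (Fin 3 → ℝ)) (e v : Frame) (a b c : ℝ) : Prop where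
  isOpen : IsOpen K
  smul_mem : ∀ {r : ℝ} {z : Fin 3 → ℝ}, 0 < r → z ∈ K → r • z ∈ K
  chart_pos : ∀ z ∈ K, 0 < e.repr z 2
  repr_pos : ∀ z ∈ K, ∀ i, 0 < v.repr z i
  a_pos : 0 < a
  b_pos : 0 < b
  c_pos : 0 < c
  mem_of_mem_triangleCone : ∀ z, ⇑(v.repr z) ∈ triangleCone a b c → z ∈ K

/-- The basis `v 1, v 2, v 0`. -/
noncomputable def rotateFrame (v : Frame) : Frame := v.reindex (finRotate 3).symm

theorem rotateFrame_apply (v : Frame) (i : Fin 3) : rotateFrame v i = v (i + 1) := by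
  simp [rotateFrame]

theorem repr_rotateFrame (v : Frame) (z : Fin 3 → ℝ) (i : Fin 3) :
    (rotateFrame v).repr z i = v.repr z (i + 1) := by
  simp [rotateFrame]

theorem repr_rotateFrame_mem_triangleCone {v : Frame} {z : Fin 3 → ℝ} {a b c : ℝ} :
    ⇑((rotateFrame v).repr z) ∈ triangleCone b c a ↔ ⇑(v.repr z) ∈ triangleCone a b c := by
  simp only [triangleCone, Set.mem_ofPred_eq, repr_rotateFrame, Fin.forall_fin_succ,
    IsEmpty.forall_iff]
  simp
  tauto

namespace IsTriangleConfig

variable {K : Set (Fin 3 → ℝ)} {e v : Frame} {a b c : ℝ}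

theorem rotate (h : IsTriangleConfig K e v a b c) :
    IsTriangleConfig K e (rotateFrame v) b c a where
  isOpen := h.isOpen
  smul_mem := h.smul_mem
  chart_pos := h.chart_pos
  repr_pos := fun z hz i => by
    rw [repr_rotateFrame]
    exact h.repr_pos z hz _
  a_pos := h.b_pos
  b_pos := h.c_pos
  c_pos := h.a_pos
  mem_of_mem_triangleCone := fun z hz =>
    h.mem_of_mem_triangleCone z (repr_rotateFrame_mem_triangleCone.1 hz)

theorem isOpen_preimage (h : IsTriangleConfig K e v a b c) : IsOpen (affineVec e ⁻¹' K) :=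
  h.isOpen.preimage (continuous_affineVec e)

theorem le_area (h : IsTriangleConfig K e v a b c) :
    ENNReal.ofReal ((Real.pi ^ 2 + Real.log (a * b * c) ^ 2) / 8)
      ≤ ∫⁻ x in chartTriangle e v a b c, pAreaDensity (hilbertNorm (affineVec e ⁻¹' K) x) :=
  le_lintegral_chartTriangle h.isOpen_preimage (fun _ hx => h.repr_pos _ hx) h.a_pos h.b_pos
    h.c_pos (fun _ hx => h.mem_of_mem_triangleCone _ hx)
    fun z hz => h.chart_pos z (h.mem_of_mem_triangleCone z hz)

/-- If `v 0` is not in the closure of `K`, neither are the nearby points of the plane `v 0 + ℝ v 1 +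
ℝ v 2`; this yields a line which separates `v 0` from the domain. -/
theorem lt_area_of_zero (h : IsTriangleConfig K e v a b c) (hv : v 0 ∉ closure K) :
    ENNReal.ofReal ((Real.pi ^ 2 + Real.log (a * b * c) ^ 2) / 8)
      < ∫⁻ x in chartTriangle e v a b c, pAreaDensity (hilbertNorm (affineVec e ⁻¹' K) x) := by
  set f : ℝ × ℝ → Fin 3 → ℝ := fun s => v 0 + s.1 • v 1 + s.2 • v 2 with hf
  have hcont : Continuous f := by
    rw [hf]
    fun_prop
  have hnhds : f ⁻¹' (closure K)ᶜ ∈ nhds ((0 : ℝ), (0 : ℝ)) :=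
    (isClosed_closure.isOpen_compl.preimage hcont).mem_nhds (by simpa [hf] using hv)
  obtain ⟨ε, hε, hball⟩ := Metric.mem_nhds_iff.1 hnhds
  have hcut : ∀ z ∈ K, ε / 2 * v.repr z 0 < v.repr z 1 + v.repr z 2 := by
    intro z hz
    by_contra! hle
    have h0 := h.repr_pos z hz 0
    have h1 := h.repr_pos z hz 1
    have h2 := h.repr_pos z hz 2
    have hfz : f (v.repr z 1 / v.repr z 0, v.repr z 2 / v.repr z 0) = (v.repr z 0)⁻¹ • z := by
      have hz' := v.sum_repr z
      rw [Fin.sum_univ_three] at hz'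
      rw [hf, eq_inv_smul_iff₀ h0.ne']
      simp only [smul_add, smul_smul, mul_div_cancel₀ _ h0.ne']
      exact hz'
    have hin : (v.repr z 1 / v.repr z 0, v.repr z 2 / v.repr z 0) ∈
        Metric.ball ((0 : ℝ), (0 : ℝ)) ε := by
      rw [Metric.mem_ball, Prod.dist_eq, max_lt_iff, Real.dist_eq, Real.dist_eq, sub_zero, sub_zero,
        abs_of_pos (by positivity), abs_of_pos (by positivity), div_lt_iff₀ h0, div_lt_iff₀ h0]
      have := mul_pos hε h0
      constructor <;> linarith
    have := hball hin
    rw [Set.mem_preimage, hfz] at this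
    exact this (subset_closure (h.smul_mem (inv_pos.2 h0) hz))
  exact lt_lintegral_chartTriangle h.isOpen_preimage (fun _ hx => h.repr_pos _ hx) h.a_pos h.b_pos
    h.c_pos (fun _ hx => h.mem_of_mem_triangleCone _ hx)
    (fun z hz => h.chart_pos z (h.mem_of_mem_triangleCone z hz)) (half_pos hε)
    fun x hx => hcut _ hx

theorem lt_area_of_rotate {D : Set (Fin 2 → ℝ)}
    (h : ENNReal.ofReal ((Real.pi ^ 2 + Real.log (b * c * a) ^ 2) / 8)
      < ∫⁻ x in chartTriangle e (rotateFrame v) b c a, pAreaDensity (hilbertNorm D x)) :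
    ENNReal.ofReal ((Real.pi ^ 2 + Real.log (a * b * c) ^ 2) / 8)
      < ∫⁻ x in chartTriangle e v a b c, pAreaDensity (hilbertNorm D x) := by
  have h1 : chartTriangle e (rotateFrame v) b c a = chartTriangle e v a b c := by
    ext x
    exact repr_rotateFrame_mem_triangleCone
  rwa [h1, show b * c * a = a * b * c by ring] at h

theorem lt_area (h : IsTriangleConfig K e v a b c) {i : Fin 3} (hv : v i ∉ closure K) :
    ENNReal.ofReal ((Real.pi ^ 2 + Real.log (a * b * c) ^ 2) / 8)
      < ∫⁻ x in chartTriangle e v a b c, pAreaDensity (hilbertNorm (affineVec e ⁻¹' K) x) := by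
  fin_cases i
  · exact h.lt_area_of_zero hv
  · exact lt_area_of_rotate (h.rotate.lt_area_of_zero (by simpa [rotateFrame_apply] using hv))
  · refine lt_area_of_rotate (lt_area_of_rotate (h.rotate.rotate.lt_area_of_zero ?_))
    simpa [rotateFrame_apply] using hv

theorem area_eq_of_forall_mem (h : IsTriangleConfig K e v a b c)
    (hK : ∀ z, (∀ i, 0 < v.repr z i) → z ∈ K) :
    ∫⁻ x in chartTriangle e v a b c, pAreaDensity (hilbertNorm (affineVec e ⁻¹' K) x)
      = ENNReal.ofReal ((Real.pi ^ 2 + Real.log (a * b * c) ^ 2) / 8) :=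
  le_antisymm (lintegral_chartTriangle_le (fun _ => ⟨h.repr_pos _, hK _⟩) h.a_pos h.b_pos
    h.c_pos fun z hz => h.chart_pos z (hK z hz)) h.le_area

end IsTriangleConfig

/-! ### Ideal triangles in the chart, and domains that are triangles -/

section

variable {Ω : Set RP2} {K : Set (Fin 3 → ℝ)} {v w : Frame} {a b c : ℝ} {k : Fin 3 → ℝ}

/-- Convexity puts the combination into the closure of `K`. Thanks to the common sign it represents
a point of the ideal triangle other than a vertex, which is off the frontier. -/
theorem IsConeOver.sum_idealVertex_mem (hK : IsConeOver K Ω)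
    (hv : ∀ z ∈ K, ∀ i, 0 < v.repr z i) (hw : IsIdealTriangle Ω w) (ha : 0 < a) (hb : 0 < b)
    (hc : 0 < c) (hk : ∀ i, k i ≠ 0) (hkw : ∀ i, w i = k i • idealVertex v a b c i)
    {d : Fin 3 → ℝ} (hd : ∀ i, 0 ≤ d i) {i j : Fin 3} (hij : i ≠ j) (hdi : d i ≠ 0)
    (hdj : d j ≠ 0) : ∑ i, d i • idealVertex v a b c i ∈ K := by
  obtain ⟨τ, hτ⟩ := hK.exists_common_sign hv hw ha hb hc hk hkw
  have hτ0 : τ ≠ 0 := by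
    rintro rfl
    simpa using hτ 0
  refine hK.mem_of_mem_closure_of_idealTriangle hv hw hk hkw hτ0 (fun n => ?_) hij hdi hdj
    (hK.sum_mem_closure (fun n => (hK.idealVertex_mem hv hw ha hb hc hkw n).1) hd)
  rw [mul_right_comm]
  exact mul_nonneg (hτ n).le (hd n)

theorem IsConeOver.isTriangleConfig (hK : IsConeOver K Ω) {e : Frame}
    (he : ∀ z ∈ K, 0 < e.repr z 2)
    (hv : ∀ z ∈ K, ∀ i, 0 < v.repr z i) (hw : IsIdealTriangle Ω w) (ha : 0 < a) (hb : 0 < b)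
    (hc : 0 < c) (hk : ∀ i, k i ≠ 0) (hkw : ∀ i, w i = k i • idealVertex v a b c i) :
    IsTriangleConfig K e v a b c where
  isOpen := hK.isOpen
  smul_mem := hK.smul_mem
  chart_pos := he
  repr_pos := hv
  a_pos := ha
  b_pos := hb
  c_pos := hc
  mem_of_mem_triangleCone := fun z hz => by
    obtain ⟨d, hd, ⟨i, j, hij, hdi, hdj⟩, rfl⟩ := exists_sum_idealVertex_eq v ha hb hc hz
    exact hK.sum_idealVertex_mem hv hw ha hb hc hk hkw hd hij hdi hdj

theorem IsConeOver.preimage_affineChart (hK : IsConeOver K Ω) {e : Frame}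
    (he : ∀ z ∈ K, 0 < e.repr z 2) : affineChart e ⁻¹' Ω = affineVec e ⁻¹' K := by
  ext x
  refine (hK.mk_mem_iff (affineVec e x) (affineVec_ne_zero e x)).trans ?_
  refine or_iff_left fun h => ?_
  have := he _ h
  simp only [map_neg, Finsupp.neg_apply, repr_affineVec_two] at this
  linarith

/-- By the common sign, non-negative weights with respect to `w` are, up to one overall sign,
non-negative weights with respect to the normalized vertices. Positivity of the coordinates in the
triangle `v` fixes that sign. -/
theorem IsConeOver.preimage_closedTriangle (hK : IsConeOver K Ω) {e : Frame}
    (he : ∀ z ∈ K, 0 < e.repr z 2)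
    (hv : ∀ z ∈ K, ∀ i, 0 < v.repr z i) (hw : IsIdealTriangle Ω w) (ha : 0 < a) (hb : 0 < b)
    (hc : 0 < c) (hk : ∀ i, k i ≠ 0) (hkw : ∀ i, w i = k i • idealVertex v a b c i) :
    affineChart e ⁻¹' (closedTriangle w ∩ Ω) = chartTriangle e v a b c := by
  obtain ⟨τ, hτ⟩ := hK.exists_common_sign hv hw ha hb hc hk hkw
  have hτ0 : τ ≠ 0 := by
    rintro rfl
    simpa using hτ 0
  rw [Set.preimage_inter, hK.preimage_affineChart he]
  ext x
  constructor
  · rintro ⟨⟨s, hs, hne, hP⟩, hxK⟩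
    have hpos := hv _ hxK
    obtain ⟨r, hr⟩ := (Projectivization.mk_eq_mk_iff' ℝ _ _ _ _).1 hP
    set d : Fin 3 → ℝ := fun i => r * s i * k i with hd
    have hsum : ∑ i, d i • idealVertex v a b c i = affineVec e x := by
      rw [← show r • ∑ i, s i • w i = affineVec e x from hr, Finset.smul_sum]
      refine Finset.sum_congr rfl fun i _ => ?_
      rw [hkw, smul_smul, smul_smul, hd]
    have hmulτ (i : Fin 3) : r * τ * (s i * (τ * k i)) = τ * τ * d i := by
      simp only [hd]
      ring
    have hττ : 0 < τ * τ := mul_self_pos.2 hτ0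
    have hsk (i : Fin 3) : 0 ≤ s i * (τ * k i) := mul_nonneg (hs i) (hτ i).le
    have hd0 : ∀ i, 0 ≤ d i := by
      rcases le_total 0 (r * τ) with h0 | h0
      · intro i
        exact nonneg_of_mul_nonneg_right (hmulτ i ▸ mul_nonneg h0 (hsk i)) hττ
      · exfalso
        have hle (i : Fin 3) : d i ≤ 0 := by
          have := mul_nonpos_of_nonpos_of_nonneg h0 (hsk i)
          rw [hmulτ] at this
          nlinarith
        have h1 := hpos 0
        rw [← hsum, repr_sum_idealVertex] at h1
        simp only [Matrix.cons_val_zero] at h1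
        nlinarith [hle 0, hle 2]
    change ⇑(v.repr (affineVec e x)) ∈ triangleCone a b c
    rw [← hsum] at hpos ⊢
    exact repr_sum_idealVertex_mem ha hb hc hd0 hpos
  · intro hx
    have hxK : affineVec e x ∈ K :=
      (hK.isTriangleConfig he hv hw ha hb hc hk hkw).mem_of_mem_triangleCone _ hx
    refine ⟨?_, hxK⟩
    obtain ⟨d, hd, -, hsum⟩ := exists_sum_idealVertex_eq v ha hb hc
      (show ⇑(v.repr (affineVec e x)) ∈ triangleCone a b c from hx)
    have hsw : ∑ i, (τ * d i / k i) • w i = τ • affineVec e x := by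
      rw [← hsum, Finset.smul_sum]
      refine Finset.sum_congr rfl fun i _ => ?_
      rw [hkw, smul_smul, smul_smul, div_mul_cancel₀ _ (hk i)]
    have hne : affineVec e x ≠ 0 := affineVec_ne_zero e x
    refine ⟨fun i => τ * d i / k i, fun i => ?_, by rw [hsw]; exact smul_ne_zero hτ0 hne, ?_⟩
    · have h1 : τ * d i / k i = τ * k i * d i / (k i * k i) := by
        have := hk i
        field_simp
      exact (div_nonneg (mul_nonneg (hτ i).le (hd i)) (mul_self_nonneg _)).trans_eq h1.symm
    · change Projectivization.mk ℝ (affineVec e x) _ = _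
      simp only [hsw]
      exact (mk_smul_eq hne _).symm

/-- If a domain is a triangle, then it agrees with every triangle which contains it and has the
vertices of an ideal triangle on its sides. -/
theorem IsConeOver.mem_of_eq_openTriangle (hK : IsConeOver K Ω)
    (hv : ∀ z ∈ K, ∀ i, 0 < v.repr z i) (hw : IsIdealTriangle Ω w) (ha : 0 < a) (hb : 0 < b)
    (hc : 0 < c) (hk : ∀ i, k i ≠ 0) (hkw : ∀ i, w i = k i • idealVertex v a b c i)
    {v' : Frame} (hv' : ∀ z, z ∈ K ↔ ∀ i, 0 < v'.repr z i) {z : Fin 3 → ℝ}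
    (hz : ∀ i, 0 < v.repr z i) : z ∈ K := by
  have hW := hK.idealVertex_mem hv hw ha hb hc hkw
  have hadd {i j : Fin 3} (hij : i ≠ j) : idealVertex v a b c i + idealVertex v a b c j ∈ K := by
    have := hK.sum_idealVertex_mem hv hw ha hb hc hk hkw
      (d := Pi.single i 1 + Pi.single j 1) (fun n => by
        simp only [Pi.add_apply, Pi.single_apply]
        split_ifs <;> norm_num) hij (by simp [hij]) (by simp [hij.symm])
    simpa [add_smul, Finset.sum_add_distrib, Pi.single_apply] using this
  set W := idealVertex v a b c with hWdef
  have hn' {z : Fin 3 → ℝ} (hz : z ∈ closure K) (i : Fin 3) : 0 ≤ v'.repr z i :=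
    repr_nonneg_of_mem_closure (fun z hz => (hv' z).1 hz) hz i
  have hvertex (i : Fin 3) : v' i ∈ closure K := by
    have h0 : (0 : ℝ) ∈ closure (Set.Ioi (0 : ℝ)) := by simp
    have := map_mem_closure (f := fun s : ℝ => v' i + s • ∑ j, v' j) (by fun_prop) h0 (t := K)
      fun s hs => (hv' _).2 fun n => by
        have h1 : v'.repr (∑ j, v' j) n = 1 := by
          simp
        have h2 : 0 ≤ v'.repr (v' i) n := by
          rw [v'.repr_self, Finsupp.single_apply]
          split_ifs <;> norm_num
        have hs : 0 < s := hs
        rw [map_add, map_smul, Finsupp.add_apply, Finsupp.smul_apply, h1, smul_eq_mul, mul_one]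
        linarith
    simpa using this
  -- Each `W j` lies on a side `σ j` of the triangle `v'`. No two lie on a common side, since `W i +
  -- W j` is interior; so `σ` is a bijection, and `W j` lies on no side other than `σ j`.
  have hex (j : Fin 3) : ∃ n, v'.repr (W j) n = 0 := by
    by_contra! hcon
    exact (hW j).2 ((hv' _).2 fun n => lt_of_le_of_ne (hn' (hW j).1 n) (hcon n).symm)
  choose σ hσ using hex
  have hpair {i j : Fin 3} (hij : i ≠ j) (n : Fin 3) :
      0 < v'.repr (W i) n + v'.repr (W j) n := by
    simpa using (hv' _).1 (hadd hij) n
  have hinj : Function.Injective σ := by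
    intro i j hij
    by_contra hne
    have h1 := hpair hne (σ i)
    rw [hσ, hij, hσ] at h1
    simp at h1
  have hsurj : Function.Surjective σ := Finite.injective_iff_surjective.1 hinj
  have hpos {j n : Fin 3} (hn : n ≠ σ j) : 0 < v'.repr (W j) n := by
    obtain ⟨l, rfl⟩ := hsurj n
    have h1 := hpair (i := j) (j := l) (fun h => hn (h ▸ rfl)) (σ l)
    rwa [hσ, add_zero] at h1
  have hexp (y : Fin 3 → ℝ) (m : Fin 3) :
      v.repr y m = ∑ n, v'.repr y n * v.repr (v' n) m := by
    conv_lhs => rw [← v'.sum_repr y]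
    simp only [map_sum, map_smul, Finsupp.finsetSum_apply, Finsupp.smul_apply, smul_eq_mul]
  have hcoef (n m : Fin 3) : 0 ≤ v.repr (v' n) m :=
    repr_nonneg_of_mem_closure hv (hvertex n) m
  -- The coordinate `j + 2` of `v` vanishes at `W j`, which is a combination with positive weights
  -- of the `v' n` with `n ≠ σ j`. It is non-negative at these, so it vanishes at them: it is a
  -- multiple of the coordinate `σ j` of `v'`, and both triangles have this side line in common.
  have hvan {j n : Fin 3} (hn : n ≠ σ j) : v.repr (v' n) (j + 2) = 0 := by
    have h1 := hexp (W j) (j + 2)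
    rw [hWdef, repr_idealVertex_add_two, ← hWdef] at h1
    have h2 := (Finset.sum_eq_zero_iff_of_nonneg fun n _ =>
      mul_nonneg (hn' (hW j).1 n) (hcoef n (j + 2))).1 h1.symm n (Finset.mem_univ n)
    exact (mul_eq_zero.1 h2).resolve_left (hpos hn).ne'
  rw [hv']
  intro n
  obtain ⟨j, rfl⟩ := hsurj n
  have h1 := hz (j + 2)
  rw [hexp z, Finset.sum_eq_single (σ j) (fun n _ hn => by rw [hvan hn, mul_zero])
    (fun h => absurd (Finset.mem_univ _) h)] at h1
  exact pos_of_mul_pos_left h1 (hcoef _ _)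

/-- The open cone spanned by the `v i` lies in the closure of `K`, and an open convex set is the
interior of its closure. -/
theorem IsConeOver.mem_of_forall_vertex_mem_closure (hK : IsConeOver K Ω)
    (hv : ∀ i, v i ∈ closure K) {z : Fin 3 → ℝ} (hz : ∀ i, 0 < v.repr z i) : z ∈ K := by
  have ho : IsOpen {z | ∀ i, 0 < v.repr z i} := by
    have : {z | ∀ i, 0 < v.repr z i} = ⋂ i, {z | 0 < v.repr z i} := by
      ext z
      simp
    rw [this]
    exact isOpen_iInter_of_finite fun i => isOpen_lt continuous_const
      (LinearMap.continuous_of_finiteDimensional (v.coord i))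
  have hsub : {z | ∀ i, 0 < v.repr z i} ⊆ closure K := by
    intro z hz
    rw [← v.sum_repr z]
    exact hK.sum_mem_closure hv fun i => (hz i).le
  have h1 : z ∈ interior (closure K) := interior_maximal hsub ho hz
  rwa [hK.convex.interior_closure_eq_interior_of_nonempty_interior
    (by rw [hK.isOpen.interior_eq]; exact hK.nonempty), hK.isOpen.interior_eq] at h1

end

/-! ### The area inequality and its equality case -/

theorem proposition1p3 (Ω : Set RP2) (hΩ : IsProperlyConvex Ω)
    (e : Frame) (he : Ω ⊆ Set.range (affineChart e))
    (w : Frame) (hw : IsIdealTriangle Ω w) (t : ℝ) (ht : IsShapeParameter Ω w t) :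
    ENNReal.ofReal ((Real.pi ^ 2 + Real.log t ^ 2) / 8)
        ≤ hilbertArea e Ω (closedTriangle w ∩ Ω) ∧
      (hilbertArea e Ω (closedTriangle w ∩ Ω)
          = ENNReal.ofReal ((Real.pi ^ 2 + Real.log t ^ 2) / 8) ↔
        ∃ v : Frame, Ω = openTriangle v) := by
  obtain ⟨K₀, hK₀⟩ := hΩ.exists_isConeOver
  obtain ⟨K, hK, heK⟩ := hK₀.exists_chart_pos he
  obtain ⟨v, hΩv, hvK, hshape⟩ : ∃ v : Frame, Ω ⊆ openTriangle v ∧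
      (∀ z ∈ K, ∀ i, 0 < v.repr z i) ∧ IsShapeInTriangle v w t := by
    obtain ⟨v, hΩv, hshape⟩ := ht
    rcases hK.repr_pos_or_neg hΩv with h | h
    · exact ⟨v, hΩv, h, hshape⟩
    · exact ⟨negFrame v, by rwa [openTriangle_negFrame], h, hshape.negFrame⟩
  obtain ⟨a, b, c, ha, hb, hc, ⟨k₀, hk₀, h₀⟩, ⟨k₁, hk₁, h₁⟩, ⟨k₂, hk₂, h₂⟩, rfl⟩ := hshape
  set k : Fin 3 → ℝ := ![k₀, k₁, k₂] with hkdef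
  have hk : ∀ i, k i ≠ 0 := by
    intro i
    fin_cases i
    · exact hk₀
    · exact hk₁
    · exact hk₂
  have hkw : ∀ i, w i = k i • idealVertex v a b c i := by
    intro i
    fin_cases i
    · exact h₀
    · exact h₁
    · exact h₂
  have hconf := hK.isTriangleConfig heK hvK hw ha hb hc hk hkw
  rw [hilbertArea, hK.preimage_closedTriangle heK hvK hw ha hb hc hk hkw,
    hK.preimage_affineChart heK]
  refine ⟨hconf.le_area, fun heq => ⟨v, hΩv.antisymm ?_⟩, ?_⟩
  · have hcl (i : Fin 3) : v i ∈ closure K := by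
      by_contra hi
      exact (hconf.lt_area hi).ne' heq
    intro P
    induction P using Projectivization.ind with
    | h z hz =>
      rw [mk_mem_openTriangle_iff, hK.mk_mem_iff]
      rintro (h | h)
      · exact Or.inl (hK.mem_of_forall_vertex_mem_closure hcl h)
      · exact Or.inr (hK.mem_of_forall_vertex_mem_closure hcl fun i => by simpa using h i)
  · rintro ⟨v₁, hv₁⟩
    obtain ⟨v', hv', hpos⟩ : ∃ v' : Frame, Ω = openTriangle v' ∧
        ∀ z ∈ K, ∀ i, 0 < v'.repr z i := by
      rcases hK.repr_pos_or_neg hv₁.subset with h | h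
      · exact ⟨v₁, hv₁, h⟩
      · exact ⟨negFrame v₁, by rw [openTriangle_negFrame, hv₁], h⟩
    refine hconf.area_eq_of_forall_mem fun z hz => ?_
    refine hK.mem_of_eq_openTriangle hvK hw ha hb hc hk hkw (v' := v')
      (fun y => ⟨hpos y, fun hy => ?_⟩) hz
    have hy0 : y ≠ 0 := by
      rintro rfl
      simpa using hy 0
    have hmem : Projectivization.mk ℝ y hy0 ∈ Ω := by
      rw [hv', mk_mem_openTriangle_iff]
      exact Or.inl hy
    refine ((hK.mk_mem_iff y hy0).1 hmem).resolve_right fun hneg => ?_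
    have h1 := hpos _ hneg 0
    simp only [map_neg, Finsupp.neg_apply] at h1
    linarith [hy 0]
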